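/- Let $S$ be a locally compact Hausdorff space with countable base, $\Delta\notin S$, and let $S^\Delta$ be the one-point compactification of $S$ (with $\Delta$ isolated if $S$ is compact). Let $d$ be any metric inducing the topology of $S$. *Path spaces.* Let $\mathbb D_{\exp}(S)$ be the set of paths $x:\mathbb R_+\to S^\Delta$ for which there is $\xi(x)\in[0,\infty]$ such that $x_t\in S$ for $t<\xi(x)$, $x_t=\Delta$ for $t\ge\xi(x)$, $x$ is right-continuous on $[0,\xi(x))$, and $x$ has left limits in $S$ on $(0,\xi(x))$. Let $\mathbb D_{\rm loc}(S)$ be the set of those $x\in\mathbb D_{\exp}(S)$ such that, if $0<\xi(x)<\infty$ and $\{x_s\}_{s<\xi(x)}$ is relatively compact in $S$, then the left limit of $x$ at $\xi(x)$ exists in $S$. Let $\mathbb D(S)=\{x\in\mathbb D_{\rm loc}(S):\xi(x)=\infty\}$, with the $\sigma$-algebra $\mathcal F$ generated by the coordinate maps $x\mapsto x_s$, $s\ge 0$. *Time changes.* Let $\Lambda$ be the set of increasing bijections $\lambda$ of $\mathbb R_+$ such that $\lambda$ and $\lambda^{-1}$ are locally Lipschitz, and put $\|\log\dot\lambda\|_t=\sup_{0\le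 s_1<s_2\le t}\bigl|\log\frac{\lambda_{s_2}-\lambda_{s_1}}{s_2-s_1}\bigr|$, with $\sup\emptyset=0$ (equivalently, the essential supremum of $|\log\dot\lambda|$ over $[0,t]$). *Local Skorokhod topology.* Say that $x^k\to x$ locally, for $x^k,x\in\mathbb D_{\rm loc}(S)$, if there are $\lambda^k\in\Lambda$ such that - either $\xi(x)<\infty$ and $\{x_s\}_{s<\xi(x)}$ is relatively compact in $S$, one has $\lambda^k_{\xi(x)}\le\xi(x^k)$ for $k$ large, and as $k\to\infty$, $\sup_{s<\xi(x)}d(x_s,x^k_{\lambda^k_s})\to0$, $x^k_{\lambda^k_{\xi(x)}}\to\Delta$ and $\|\log\dot\lambda^k\|_{\xi(x)}\to0$; - or $\xi(x)=\infty$ or $\{x_s\}_{s<\xi(x)}$ is not relatively compact in $S$, and for all $t<\xi(x)$ one has $\lambda^k_t<\xi(x^k)$ for $k$ large, $\sup_{s\le t}d(x_s,x^k_{\lambda^k_s})\to0$ and $\|\log\dot\lambda^k\|_t\to0$. The local Skorokhod topology on $\mathbb D_{\rm loc}(S)$ is the Polish topology whose convergent sequences are exactly these. It is the topology in which $U$ is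 open if and only if every sequence converging locally to a point of $U$ is eventually in $U$. The global Skorokhod topology is its trace on $\mathbb D(S)$. **Statement.** The global Skorokhod topology on $\mathbb D(S)$ is Polish. A sequence $(x^k)_k$ in $\mathbb D(S)$ converges to $x\in\mathbb D(S)$ for this topology if and only if there is a sequence $(\lambda^k)_k$ in $\Lambda$ such that for all $t\ge0$ $$\sup_{s\le t}d(x_s,x^k_{\lambda^k_s})\to0\quad\text{and}\quad\|\log\dot\lambda^k\|_t\to0\qquad(k\to\infty).$$ The global Skorokhod topology does not depend on the metric $d$, but only on the topology of $S$. Its Borel $\sigma$-algebra coincides with $\mathcal F$. -/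

import Mathlib

open Filter Topology NNReal ENNReal

noncomputable section

namespace Skorokhod

variable {S : Type*} [TopologicalSpace S]

/-! Paths are functions `ℝ₊ → S^Δ`, where `S^Δ = OnePoint S`. The added point `Δ = OnePoint.infty` is
isolated when `S` is compact. -/

/-- The explosion time `ξ(x) ∈ [0, ∞]`: the infimum of the times at which the path is at `Δ`. -/
def explosionTime (x : ℝ≥0 → OnePoint S) : ℝ≥0∞ :=
  ⨅ (t : ℝ≥0) (_ : x t = OnePoint.infty), (t : ℝ≥0∞)

/-- The path stays before its explosion time in some compact subset of `S`, i.e.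
`{x_s}_{s < ξ(x)} ⋐ S`. -/
def IsRelCompactPath (x : ℝ≥0 → OnePoint S) : Prop :=
  ∃ K : Set S, IsCompact K ∧
    ∀ s : ℝ≥0, (s : ℝ≥0∞) < explosionTime x → ∃ a ∈ K, x s = (a : OnePoint S)

variable (S) in
/-- The exploding cadlag paths: `x` lies in `S` on `[0, ξ(x))` (by the definition of `ξ`), is at
`Δ` from time `ξ(x)` on, is right-continuous on `[0, ξ(x))`, and has left limits in `S` on
`(0, ξ(x))`. -/
def DExp : Set (ℝ≥0 → OnePoint S) :=
  {x | (∀ t : ℝ≥0, explosionTime x ≤ t → x t = OnePoint.infty) ∧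
    (∀ t : ℝ≥0, (t : ℝ≥0∞) < explosionTime x → Tendsto x (𝓝[>] t) (𝓝 (x t))) ∧
    (∀ t : ℝ≥0, 0 < t → (t : ℝ≥0∞) < explosionTime x →
      ∃ a : S, Tendsto x (𝓝[<] t) (𝓝 (a : OnePoint S)))}

variable (S) in
/-- The local cadlag space: if `ξ(x) ∈ (0, ∞)` and `{x_s}_{s < ξ(x)} ⋐ S`, then the left limit
at `ξ(x)` exists in `S`. -/
def DLoc : Set (ℝ≥0 → OnePoint S) :=
  {x | x ∈ DExp S ∧
    (0 < explosionTime x → explosionTime x < ⊤ → IsRelCompactPath x →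
      ∃ a : S, Tendsto x (𝓝[<] (explosionTime x).toNNReal) (𝓝 (a : OnePoint S)))}

variable (S) in
/-- The global cadlag space `D(S)`, as a subset of the local cadlag space. -/
def DGlob : Set (DLoc S) := {x | explosionTime x.1 = ⊤}

variable (S) in
/-- The `σ`-algebra on `D(S)` generated by the coordinates `X_s`, `s ≥ 0`. -/
@[reducible]
def canonicalSigma : MeasurableSpace (DGlob S) :=
  ⨆ s : ℝ≥0, MeasurableSpace.comap (fun x : DGlob S => x.1.1 s) (borel (OnePoint S))

/-- The set `Λ` of increasing bijections of `ℝ₊` that are locally Lipschitz together with their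
inverse. -/
def timeChanges : Set (ℝ≥0 ≃o ℝ≥0) := {l | LocallyLipschitz l ∧ LocallyLipschitz l.symm}

/-- `‖log λ̇‖_t`, as the supremum of `|log ((λ s₂ - λ s₁) / (s₂ - s₁))|` over
`0 ≤ s₁ < s₂ ≤ t`. -/
def logSlopeNorm (l : ℝ≥0 ≃o ℝ≥0) (t : ℝ≥0) : ℝ≥0∞ :=
  ⨆ (s₁ : ℝ≥0) (s₂ : ℝ≥0) (_ : s₁ < s₂) (_ : s₂ ≤ t),
    ENNReal.ofReal |Real.log (((l s₂ : ℝ) - l s₁) / ((s₂ : ℝ) - s₁))|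

/-- A metric on `S` that induces the given topology of `S`. -/
structure CompatMetric (S : Type*) [tS : TopologicalSpace S] where
  /-- the metric -/
  metric : MetricSpace S
  /-- it induces the given topology -/
  induces : metric.toUniformSpace.toTopologicalSpace = tS

/-- The distance of `S`, extended to `S^Δ` by the value `∞` between `Δ` and a point of `S`. -/
def distExt (d : CompatMetric S) : OnePoint S → OnePoint S → ℝ≥0∞
  | .some a, .some b => ENNReal.ofReal (d.metric.dist a b)
  | .infty, .infty => 0
  | _, _ => ⊤

/-- `sup_{s ∈ I} d(x_s, y_{λ_s})`. -/
def supDist (d : CompatMetric S) (I : Set ℝ≥0) (x y : ℝ≥0 → OnePoint S) (l : ℝ≥0 ≃o ℝ≥0) : ℝ≥0∞ :=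
  ⨆ s ∈ I, distExt d (x s) (y (l s))

/-- The convergence of sequences in the local cadlag space. -/
def LocConv (d : CompatMetric S) (xs : ℕ → DLoc S) (x : DLoc S) : Prop :=
  ∃ l : ℕ → ℝ≥0 ≃o ℝ≥0, (∀ k, l k ∈ timeChanges) ∧
    (((explosionTime x.1 < ⊤ ∧ IsRelCompactPath x.1) ∧
        (∀ᶠ k in atTop, (l k (explosionTime x.1).toNNReal : ℝ≥0∞) ≤ explosionTime (xs k).1) ∧
        Tendsto (fun k => supDist d (Set.Iio (explosionTime x.1).toNNReal) x.1 (xs k).1 (l k))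
          atTop (𝓝 0) ∧
        Tendsto (fun k => (xs k).1 (l k (explosionTime x.1).toNNReal)) atTop
          (𝓝 (OnePoint.infty : OnePoint S)) ∧
        Tendsto (fun k => logSlopeNorm (l k) (explosionTime x.1).toNNReal) atTop (𝓝 0)) ∨
      ((explosionTime x.1 = ⊤ ∨ ¬ IsRelCompactPath x.1) ∧
        ∀ t : ℝ≥0, (t : ℝ≥0∞) < explosionTime x.1 →
          (∀ᶠ k in atTop, (l k t : ℝ≥0∞) < explosionTime (xs k).1) ∧
          Tendsto (fun k => supDist d (Set.Iic t) x.1 (xs k).1 (l k)) atTop (𝓝 0) ∧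
          Tendsto (fun k => logSlopeNorm (l k) t) atTop (𝓝 0)))

/-- The local Skorokhod topology: a set is open iff it eventually contains every sequence that
converges, in the sense of `LocConv`, to one of its points. By `eq_localSkorokhod`, no other
Polish topology can have `LocConv` as its convergence of sequences. -/
@[reducible]
def localSkorokhod (d : CompatMetric S) : TopologicalSpace (DLoc S) where
  IsOpen U := ∀ x ∈ U, ∀ xs : ℕ → DLoc S, LocConv d xs x → ∀ᶠ k in atTop, xs k ∈ U
  isOpen_univ := fun _ _ _ _ => Eventually.of_forall fun _ => trivial
  isOpen_inter := fun _ _ hU hV x hx xs h => (hU x hx.1 xs h).and (hV x hx.2 xs h)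
  isOpen_sUnion := fun _ hU x ⟨V, hV, hx⟩ xs h =>
    (hU V hV x hx xs h).mono fun _ hk => ⟨V, hV, hk⟩

/-- A Polish topology on the local cadlag space in which a sequence converges iff it satisfies
`LocConv` is the local Skorokhod topology. -/
theorem eq_localSkorokhod (d : CompatMetric S) (τ : TopologicalSpace (DLoc S))
    (hP : @PolishSpace _ τ)
    (h : ∀ (xs : ℕ → DLoc S) (x : DLoc S), Tendsto xs atTop (@nhds _ τ x) ↔ LocConv d xs x) :
    τ = localSkorokhod d := by
  ext U
  constructor
  · intro hU x hx xs hxs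
    exact ((h xs x).2 hxs).eventually (hU.mem_nhds hx)
  · intro hU
    rw [← isClosed_compl_iff]
    apply IsSeqClosed.isClosed
    intro xs x hxs hx hxU
    obtain ⟨k, hk⟩ := (hU x hxU xs ((h xs x).1 hx)).exists
    exact hxs k hk

/-- The trace on `D(S)` of the local Skorokhod topology. -/
@[reducible]
def globalSkorokhod (d : CompatMetric S) : TopologicalSpace (DGlob S) :=
  TopologicalSpace.induced Subtype.val (localSkorokhod d)

end Skorokhod

end

/-! A path of infinite lifetime is a cadlag function into `S`. For such functions `f`, `g` let
`Close ρ ε f g` mean that a time change with logarithmic slopes at most `ε` on all of `ℝ₊` brings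
`g` within `ε` of `f` on `[0, 1/ε]`. Inverting and composing time changes shows that these relations
generate a countably based uniformity. It is complete when the metric is, because time changes with
summable logarithmic slopes have an infinite composition. It is separable because, up to a time
change, a path on `[0, T]` is described by finitely many centres and discretised interval lengths.

The link with the local topology, which is defined through sequences, is
`hasBasis_nhds_globalSkorokhod`: the trace on `D(S)` has the relations `Close` as neighbourhood
bases. One inclusion turns closeness at scales tending to `0` into local convergence; the other
needs the openness of `localNhd`. The convergence criterion follows.

Since a cadlag path stays in a compact set on `[0, T]`, the metric does not matter
(`exists_close_imp_close`). As `S` is Polish, the metric may be taken complete, and the topology is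
Polish. The evaluations at a countable dense set of times are measurable and jointly injective, so
by Lusin–Souslin they generate the Borel sets. -/

namespace Skorokhod

/-! ### Time changes and their logarithmic slopes -/

/-- The slopes of `f` lie in `[exp (-ε), exp ε]`. -/
def LogSlopeLE (ε : ℝ) (f : ℝ≥0 → ℝ≥0) : Prop :=
  ∀ ⦃s t : ℝ≥0⦄, s ≤ t → Real.exp (-ε) * ((t : ℝ) - s) ≤ (f t : ℝ) - f s ∧
    (f t : ℝ) - f s ≤ Real.exp ε * ((t : ℝ) - s)

namespace LogSlopeLE

variable {ε δ : ℝ} {f g : ℝ≥0 → ℝ≥0}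

theorem monotone (h : LogSlopeLE ε f) : Monotone f := by
  intro s t hst
  have h1 := (h hst).1
  have h2 : (0 : ℝ) ≤ Real.exp (-ε) * ((t : ℝ) - s) :=
    mul_nonneg (Real.exp_pos _).le (sub_nonneg.2 (by exact_mod_cast hst))
  exact NNReal.coe_le_coe.1 (by linarith)

theorem strictMono (h : LogSlopeLE ε f) : StrictMono f := by
  intro s t hst
  have h1 := (h hst.le).1
  have h2 : (0 : ℝ) < Real.exp (-ε) * ((t : ℝ) - s) :=
    mul_pos (Real.exp_pos _) (sub_pos.2 (by exact_mod_cast hst))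
  exact NNReal.coe_lt_coe.1 (by linarith)

theorem mono (h : LogSlopeLE ε f) (hε : ε ≤ δ) : LogSlopeLE δ f := by
  intro s t hst
  have h0 : (0 : ℝ) ≤ (t : ℝ) - s := sub_nonneg.2 (by exact_mod_cast hst)
  refine ⟨le_trans ?_ (h hst).1, (h hst).2.trans ?_⟩ <;> gcongr

theorem id (hε : 0 ≤ ε) : LogSlopeLE ε (fun s => s) := by
  have h : LogSlopeLE 0 (fun s => s) := fun s t _ => by simp
  exact h.mono hε

theorem comp (hg : LogSlopeLE δ g) (hf : LogSlopeLE ε f) :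
    LogSlopeLE (ε + δ) (fun s => g (f s)) := by
  intro s t hst
  have h1 := hf hst
  have h2 := hg (hf.monotone hst)
  have e1 := Real.exp_pos δ
  have e2 := Real.exp_pos (-δ)
  rw [neg_add, Real.exp_add, Real.exp_add]
  constructor
  · calc _ = Real.exp (-δ) * (Real.exp (-ε) * ((t : ℝ) - s)) := by ring
      _ ≤ Real.exp (-δ) * ((f t : ℝ) - f s) := by gcongr; exact h1.1
      _ ≤ _ := h2.1
  · calc _ ≤ Real.exp δ * ((f t : ℝ) - f s) := h2.2
      _ ≤ Real.exp δ * (Real.exp ε * ((t : ℝ) - s)) := by gcongr; exact h1.2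
      _ = _ := by ring

theorem symm {l : ℝ≥0 ≃o ℝ≥0} (h : LogSlopeLE ε l) : LogSlopeLE ε l.symm := by
  intro s t hst
  have h1 := h (l.symm.monotone hst)
  simp only [OrderIso.apply_symm_apply] at h1
  have e : Real.exp ε * Real.exp (-ε) = 1 := by rw [← Real.exp_add]; simp
  have e1 := Real.exp_pos ε
  have e2 := Real.exp_pos (-ε)
  constructor
  · calc _ ≤ Real.exp (-ε) * (Real.exp ε * ((l.symm t : ℝ) - l.symm s)) := by
          gcongr; exact h1.2
      _ = (Real.exp ε * Real.exp (-ε)) * ((l.symm t : ℝ) - l.symm s) := by ring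
      _ = _ := by rw [e, one_mul]
  · calc (l.symm t : ℝ) - l.symm s
        = Real.exp ε * (Real.exp (-ε) * ((l.symm t : ℝ) - l.symm s)) := by
          rw [← mul_assoc, e, one_mul]
      _ ≤ _ := by gcongr; exact h1.1

theorem le_mul (h : LogSlopeLE ε f) (h0 : f 0 = 0) (s : ℝ≥0) : (f s : ℝ) ≤ Real.exp ε * s := by
  simpa [h0] using (h zero_le).2

theorem abs_sub_le (h : LogSlopeLE ε f) (h0 : f 0 = 0) (s : ℝ≥0) :
    |(f s : ℝ) - s| ≤ (Real.exp ε - 1) * s := by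
  have h1 := h (zero_le (a := s))
  simp only [h0, NNReal.coe_zero, sub_zero] at h1
  -- This turns the lower bound `(exp (-ε) - 1) * s` for `f s - s` into `-(exp ε - 1) * s`.
  have h2 : 2 ≤ Real.exp ε + Real.exp (-ε) := by
    have := Real.one_le_cosh ε
    rw [Real.cosh_eq] at this
    linarith
  rw [abs_le]
  constructor <;> nlinarith [s.2]

theorem lipschitzWith (h : LogSlopeLE ε f) : LipschitzWith (Real.exp ε).toNNReal f := by
  refine LipschitzWith.of_dist_le_mul fun s t => ?_
  rw [Real.coe_toNNReal _ (Real.exp_pos _).le, NNReal.dist_eq, NNReal.dist_eq]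
  rcases le_total s t with hst | hst
  · rw [abs_sub_comm, abs_sub_comm (s : ℝ),
      abs_of_nonneg (sub_nonneg.2 (by exact_mod_cast h.monotone hst)),
      abs_of_nonneg (sub_nonneg.2 (by exact_mod_cast hst))]
    exact (h hst).2
  · rw [abs_of_nonneg (sub_nonneg.2 (by exact_mod_cast h.monotone hst)),
      abs_of_nonneg (sub_nonneg.2 (by exact_mod_cast hst))]
    exact (h hst).2

theorem mem_timeChanges {l : ℝ≥0 ≃o ℝ≥0} (h : LogSlopeLE ε l) : l ∈ timeChanges :=
  ⟨h.lipschitzWith.locallyLipschitz, h.symm.lipschitzWith.locallyLipschitz⟩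

theorem exists_orderIso (h : LogSlopeLE ε f) (h0 : f 0 = 0) : ∃ l : ℝ≥0 ≃o ℝ≥0, ⇑l = f := by
  have hsurj : Function.Surjective f := by
    intro y
    -- The slope bound from below gives `f b ≥ exp (-ε) * b = y`, so the intermediate value theorem
    -- applies on `[0, b]`.
    set b : ℝ≥0 := (Real.exp ε).toNNReal * y with hb
    have hy : y ≤ f b := by
      have h1 := (h (zero_le (a := b))).1
      have e : Real.exp (-ε) * Real.exp ε = 1 := by rw [← Real.exp_add]; simp
      simp only [h0, NNReal.coe_zero, sub_zero, hb, NNReal.coe_mul,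
        Real.coe_toNNReal _ (Real.exp_pos ε).le, ← mul_assoc, e, one_mul] at h1
      exact_mod_cast h1
    obtain ⟨s, -, hs⟩ := intermediate_value_Icc zero_le h.lipschitzWith.continuous.continuousOn
      (show y ∈ Set.Icc (f 0) (f b) from ⟨by simp [h0], hy⟩)
    exact ⟨s, hs⟩
  exact ⟨h.strictMono.orderIsoOfSurjective f hsurj, rfl⟩

end LogSlopeLE

theorem timeChange_zero (l : ℝ≥0 ≃o ℝ≥0) : l 0 = 0 := l.map_bot

/-- Gluing a time change on `[0, b]` with a time change after `b`. -/
theorem exists_glue {ε : ℝ} {l m : ℝ≥0 ≃o ℝ≥0} {b : ℝ≥0}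
    (hl : ∀ s t : ℝ≥0, s ≤ t → t ≤ b → Real.exp (-ε) * ((t : ℝ) - s) ≤ (l t : ℝ) - l s ∧
      (l t : ℝ) - l s ≤ Real.exp ε * ((t : ℝ) - s))
    (hm : LogSlopeLE ε m) :
    ∃ k : ℝ≥0 ≃o ℝ≥0, LogSlopeLE ε k ∧ (∀ s ≤ b, k s = l s) ∧ ∀ s, k (b + s) = l b + m s := by
  set f : ℝ≥0 → ℝ≥0 := fun s => if s ≤ b then l s else l b + m (s - b) with hf
  have f1 : ∀ s ≤ b, f s = l s := fun s hs => by simp [hf, hs]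
  have f2 : ∀ s, f (b + s) = l b + m s := by
    intro s
    rcases eq_or_ne s 0 with rfl | hs
    · simp [hf, timeChange_zero]
    · have : ¬ b + s ≤ b := by
        simpa using hs
      simp [hf, this]
  have hslope : LogSlopeLE ε f := by
    intro s t hst
    rcases le_total t b with htb | htb
    · rw [f1 t htb, f1 s (hst.trans htb)]
      exact hl s t hst htb
    · obtain ⟨t, rfl⟩ := exists_add_of_le htb
      rcases le_total s b with hsb | hsb
      · have h1 := hl s b hsb le_rfl
        have h2 := hm (zero_le (a := t))
        rw [f1 s hsb, f2 t]
        simp only [timeChange_zero, NNReal.coe_zero, sub_zero, NNReal.coe_add] at h2 ⊢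
        constructor <;> linarith
      · obtain ⟨s, rfl⟩ := exists_add_of_le hsb
        have h2 := hm (le_of_add_le_add_left hst)
        rw [f2, f2]
        simp only [NNReal.coe_add]
        constructor <;> linarith
  obtain ⟨k, hk⟩ := hslope.exists_orderIso (by rw [f1 0 zero_le, timeChange_zero])
  exact ⟨k, hk ▸ hslope, fun s hs => by rw [hk, f1 s hs], fun s => by rw [hk, f2]⟩

/-- A linear time change. -/
theorem exists_linear {ε : ℝ} {a b : ℝ≥0} (ha : 0 < a) (hb : 0 < b)
    (h1 : (b : ℝ) ≤ Real.exp ε * a) (h2 : (a : ℝ) ≤ Real.exp ε * b) :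
    ∃ l : ℝ≥0 ≃o ℝ≥0, LogSlopeLE ε l ∧ l a = b := by
  have hs : LogSlopeLE ε (fun s => b / a * s) := by
    intro s t hst
    have h0 : (0 : ℝ) ≤ (t : ℝ) - s := sub_nonneg.2 (by exact_mod_cast hst)
    have ha' : (0 : ℝ) < a := ha
    have hb' : (0 : ℝ) < b := hb
    have e : Real.exp (-ε) * Real.exp ε = 1 := by rw [← Real.exp_add]; simp
    push_cast
    rw [← mul_sub]
    constructor
    · gcongr
      rw [le_div_iff₀ ha']
      calc _ ≤ Real.exp (-ε) * (Real.exp ε * b) := by gcongr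
        _ = _ := by rw [← mul_assoc, e, one_mul]
    · gcongr
      rwa [div_le_iff₀ ha']
  obtain ⟨l, hl⟩ := hs.exists_orderIso (by simp)
  refine ⟨l, hl ▸ hs, ?_⟩
  rw [hl]
  exact div_mul_cancel₀ b ha.ne'

theorem logSlopeNorm_le_iff {ε : ℝ} (hε : 0 ≤ ε) (l : ℝ≥0 ≃o ℝ≥0) (b : ℝ≥0) :
    logSlopeNorm l b ≤ ENNReal.ofReal ε ↔ ∀ s t : ℝ≥0, s ≤ t → t ≤ b →
      Real.exp (-ε) * ((t : ℝ) - s) ≤ (l t : ℝ) - l s ∧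
      (l t : ℝ) - l s ≤ Real.exp ε * ((t : ℝ) - s) := by
  simp only [logSlopeNorm, iSup_le_iff, ENNReal.ofReal_le_ofReal_iff hε]
  have key : ∀ s t : ℝ≥0, s < t → (|Real.log (((l t : ℝ) - l s) / ((t : ℝ) - s))| ≤ ε ↔
      Real.exp (-ε) * ((t : ℝ) - s) ≤ (l t : ℝ) - l s ∧
      (l t : ℝ) - l s ≤ Real.exp ε * ((t : ℝ) - s)) := by
    intro s t hst
    have h0 : (0 : ℝ) < (t : ℝ) - s := sub_pos.2 (by exact_mod_cast hst)
    have h1 : (0 : ℝ) < (l t : ℝ) - l s := sub_pos.2 (by exact_mod_cast l.strictMono hst)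
    rw [abs_le, Real.le_log_iff_exp_le (by positivity), Real.log_le_iff_le_exp (by positivity),
      le_div_iff₀ h0, div_le_iff₀ h0]
  constructor
  · intro h s t hst htb
    rcases hst.eq_or_lt with rfl | hst
    · simp
    · exact (key s t hst).1 (h s t hst htb)
  · intro h s t hst htb
    exact (key s t hst).2 (h s t hst.le htb)

theorem LogSlopeLE.logSlopeNorm_le {ε : ℝ} (hε : 0 ≤ ε) {l : ℝ≥0 ≃o ℝ≥0} (h : LogSlopeLE ε l)
    (b : ℝ≥0) : logSlopeNorm l b ≤ ENNReal.ofReal ε :=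
  (logSlopeNorm_le_iff hε l b).2 fun _ _ hst _ => h hst

/-- The slope of a composition is a product of slopes, and logarithms turn it into a sum; the second
factor is only seen on `[0, l b]`. -/
theorem logSlopeNorm_trans_le (l m : ℝ≥0 ≃o ℝ≥0) (b : ℝ≥0) :
    logSlopeNorm (l.trans m) b ≤ logSlopeNorm l b + logSlopeNorm m (l b) := by
  refine iSup_le fun s => iSup_le fun t => iSup_le fun hst => iSup_le fun htb => ?_
  have h0 : (0 : ℝ) < (t : ℝ) - s := sub_pos.2 (by exact_mod_cast hst)
  have h1 : (0 : ℝ) < (l t : ℝ) - l s := sub_pos.2 (by exact_mod_cast l.strictMono hst)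
  have h2 : (0 : ℝ) < (m (l t) : ℝ) - m (l s) :=
    sub_pos.2 (by exact_mod_cast m.strictMono (l.strictMono hst))
  have e : ((l.trans m t : ℝ) - l.trans m s) / ((t : ℝ) - s) =
      (((l t : ℝ) - l s) / ((t : ℝ) - s)) *
        (((m (l t) : ℝ) - m (l s)) / ((l t : ℝ) - l s)) := by
    simp only [OrderIso.trans_apply]
    field_simp
  rw [e, Real.log_mul (by positivity) (by positivity)]
  refine (ENNReal.ofReal_le_ofReal (abs_add_le _ _)).trans (ENNReal.ofReal_add_le.trans ?_)
  refine add_le_add ?_ ?_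
  · exact le_iSup_of_le s (le_iSup_of_le t (le_iSup_of_le hst (le_iSup_of_le htb le_rfl)))
  · exact le_iSup_of_le (l s) (le_iSup_of_le (l t) (le_iSup_of_le (l.strictMono hst)
      (le_iSup_of_le (l.monotone htb) le_rfl)))

theorem logSlopeNorm_mono (l : ℝ≥0 ≃o ℝ≥0) {a b : ℝ≥0} (h : a ≤ b) :
    logSlopeNorm l a ≤ logSlopeNorm l b :=
  iSup_mono fun _ => iSup_mono fun _ => iSup_mono fun _ =>
    iSup_le fun hs => le_iSup_of_le (hs.trans h) le_rfl

theorem trans_mem_timeChanges {l m : ℝ≥0 ≃o ℝ≥0} (hl : l ∈ timeChanges) (hm : m ∈ timeChanges) :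
    l.trans m ∈ timeChanges :=
  ⟨hm.1.comp hl.1, hl.2.comp hm.2⟩

/-! ### Cadlag functions and closeness up to a time change -/

/-- Right-continuity with left limits, for paths with infinite lifetime. -/
def IsCadlag {S : Type*} [TopologicalSpace S] (f : ℝ≥0 → S) : Prop :=
  (∀ t, Tendsto f (𝓝[>] t) (𝓝 (f t))) ∧ ∀ t, 0 < t → ∃ a, Tendsto f (𝓝[<] t) (𝓝 a)

/-- A transitive relation on times that holds locally on both sides of every time holds
between `0` and every time. -/
theorem rel_zero_of_locally {P : ℝ≥0 → ℝ≥0 → Prop} (hrefl : P 0 0)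
    (htrans : ∀ a b c, P a b → P b c → P a c)
    (hright : ∀ t, ∀ᶠ r in 𝓝[>] t, P t r) (hleft : ∀ t, 0 < t → ∀ᶠ r in 𝓝[<] t, P r t)
    (T : ℝ≥0) : P 0 T := by
  set A : Set ℝ≥0 := {t | t ≤ T ∧ P 0 t} with hA
  have hne : A.Nonempty := ⟨0, zero_le, hrefl⟩
  have hbdd : BddAbove A := ⟨T, fun t ht => ht.1⟩
  set τ := sSup A with hτ
  have hτT : τ ≤ T := csSup_le hne fun t ht => ht.1
  -- The left-hand property shows that the supremum is attained; the right-hand property would push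
  -- it further if it were below `T`.
  have hPτ : P 0 τ := by
    rcases eq_or_ne τ 0 with h0 | h0
    · rw [h0]; exact hrefl
    · have hpos : 0 < τ := pos_iff_ne_zero.2 h0
      obtain ⟨a, ha, hsub⟩ := (mem_nhdsLT_iff_exists_Ioo_subset' hpos).1 (hleft τ hpos)
      obtain ⟨t, ht, hat⟩ := exists_lt_of_lt_csSup hne ha
      rcases (le_csSup hbdd ht).eq_or_lt with h | h
      · rw [hτ, ← h]; exact ht.2
      · exact htrans _ _ _ ht.2 (hsub ⟨hat, h⟩)
  rcases hτT.eq_or_lt with h | h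
  · rwa [← h]
  · obtain ⟨r, hPr, hr⟩ := ((hright τ).and (Ioc_mem_nhdsGT h)).exists
    exact absurd (le_csSup hbdd (show r ∈ A from ⟨hr.2, htrans _ _ _ hPτ hPr⟩)) hr.1.not_ge

theorem IsCadlag.exists_isCompact {S : Type*} [TopologicalSpace S] [LocallyCompactSpace S]
    {f : ℝ≥0 → S} (hf : IsCadlag f) (T : ℝ≥0) : ∃ K : Set S, IsCompact K ∧ ∀ s ≤ T, f s ∈ K := by
  have key := rel_zero_of_locally
    -- The intervals are half-open, so that to the left of `b` only the left limit at `b` matters.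
    -- Going up to `T + 1` then covers the time `T` itself.
    (P := fun a b => ∃ K : Set S, IsCompact K ∧ ∀ s, a ≤ s → s < b → f s ∈ K)
    ⟨∅, isCompact_empty, fun s _ h => absurd h (by simp)⟩ ?_ ?_ ?_ (T + 1)
  · obtain ⟨K, hK, h⟩ := key
    exact ⟨K, hK, fun s hs => h s zero_le (hs.trans_lt (by simp))⟩
  · rintro a b c ⟨K, hK, h⟩ ⟨L, hL, h'⟩
    refine ⟨K ∪ L, hK.union hL, fun s has hsc => ?_⟩
    rcases lt_or_ge s b with hsb | hsb
    · exact .inl (h s has hsb)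
    · exact .inr (h' s hsb hsc)
  · intro t
    obtain ⟨K, hK, hKt⟩ := exists_compact_mem_nhds (f t)
    obtain ⟨u, hu, hsub⟩ := (mem_nhdsGT_iff_exists_Ioo_subset).1 ((hf.1 t) hKt)
    filter_upwards [Ioo_mem_nhdsGT hu] with r hr
    refine ⟨K, hK, fun s hts hsr => ?_⟩
    rcases hts.eq_or_lt with rfl | hts
    · exact mem_of_mem_nhds hKt
    · exact hsub ⟨hts, hsr.trans hr.2⟩
  · intro t ht
    obtain ⟨a, ha⟩ := hf.2 t ht
    obtain ⟨K, hK, hKt⟩ := exists_compact_mem_nhds a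
    obtain ⟨u, hu, hsub⟩ := (mem_nhdsLT_iff_exists_Ioo_subset' ht).1 (ha hKt)
    filter_upwards [Ioo_mem_nhdsLT hu] with r hr
    exact ⟨K, hK, fun s hrs hst => hsub ⟨hr.1.trans_le hrs, hst⟩⟩

/-- The time change `l` has logarithmic slopes at most `ε` and brings `g` within `ε` of `f` on
`[0, 1 / ε]`, for the distance function `ρ`. -/
def Matches {S : Type*} (ρ : S → S → ℝ) (ε : ℝ) (f g : ℝ≥0 → S) (l : ℝ≥0 ≃o ℝ≥0) : Prop :=
  LogSlopeLE ε l ∧ ∀ s : ℝ≥0, (s : ℝ) * ε ≤ 1 → ρ (f s) (g (l s)) ≤ ε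

/-- Some time change matches `g` to `f` up to `ε`. -/
def Close {S : Type*} (ρ : S → S → ℝ) (ε : ℝ) (f g : ℝ≥0 → S) : Prop :=
  ∃ l, Matches ρ ε f g l

theorem Matches.mono {S : Type*} {ρ : S → S → ℝ} {ε δ : ℝ} {f g : ℝ≥0 → S} {l : ℝ≥0 ≃o ℝ≥0}
    (h : Matches ρ ε f g l) (hε : ε ≤ δ) : Matches ρ δ f g l :=
  ⟨h.1.mono hε, fun s hs => (h.2 s ((mul_le_mul_of_nonneg_left hε s.2).trans hs)).trans hε⟩

theorem Close.mono {S : Type*} {ρ : S → S → ℝ} {ε δ : ℝ} {f g : ℝ≥0 → S}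
    (h : Close ρ ε f g) (hε : ε ≤ δ) : Close ρ δ f g :=
  h.imp fun _ hl => hl.mono hε

/-- Only `a` is confined to the compact set: the second path in a comparison may leave it. -/
theorem exists_forall_mem_compact_dist_lt {α β : Type*} [PseudoMetricSpace α] [PseudoMetricSpace β]
    {f : α → β} (hf : Continuous f) {K : Set α} (hK : IsCompact K) {ε : ℝ} (hε : 0 < ε) :
    ∃ δ > 0, ∀ a ∈ K, ∀ b, dist a b < δ → dist (f a) (f b) < ε := by
  obtain ⟨δ, hδ, h⟩ := Metric.mem_uniformity_dist.1
    (hK.uniformContinuousAt_of_continuousAt f (fun a _ => hf.continuousAt)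
      (Metric.dist_mem_uniformity hε))
  exact ⟨δ, hδ, fun a ha b hab => h hab ha⟩

/-- The same time change serves for both metrics: `f` stays in a compact set on `[0, 1/ε]`, and at
its points `d`-closeness forces `d'`-closeness uniformly, whatever the values of `g`. -/
theorem exists_close_imp_close {S : Type*} [TopologicalSpace S] [LocallyCompactSpace S]
    (d d' : CompatMetric S) {f : ℝ≥0 → S} (hf : IsCadlag f) {ε : ℝ} (hε : 0 < ε) :
    ∃ δ > 0, ∀ g, Close d.metric.dist δ f g → Close d'.metric.dist ε f g := by
  obtain ⟨K, hK, hfK⟩ := hf.exists_isCompact (1 / ε).toNNReal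
  obtain ⟨δ, hδ, h⟩ : ∃ δ > 0, ∀ a ∈ K, ∀ b, d.metric.dist a b < δ → d'.metric.dist a b < ε := by
    obtain ⟨m, h⟩ := d
    obtain ⟨m', h'⟩ := d'
    subst h
    exact @exists_forall_mem_compact_dist_lt S S m.toPseudoMetricSpace m'.toPseudoMetricSpace id
      (continuous_id_iff_le.2 h'.ge) K hK ε hε
  refine ⟨min (δ / 2) ε, by positivity, fun g ⟨l, hl, hs⟩ =>
    ⟨l, hl.mono (min_le_right _ _), fun s hsε => (h _ (hfK s ?_) _ ?_).le⟩⟩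
  · rw [← NNReal.coe_le_coe, Real.coe_toNNReal _ (by positivity), le_div_iff₀ hε]
    exact hsε
  · refine (hs s ((mul_le_mul_of_nonneg_left (min_le_right _ _) s.2).trans hsε)).trans_lt ?_
    exact (min_le_left _ _).trans_lt (half_lt_self hδ)

/-! ### The Skorokhod uniformity -/

/-- The cadlag paths with values in `S`. -/
def CadlagPath (S : Type*) [TopologicalSpace S] : Type _ := {f : ℝ≥0 → S // IsCadlag f}

section Metric

variable {S : Type*} [MetricSpace S]

theorem Close.refl (f : ℝ≥0 → S) {ε : ℝ} (hε : 0 ≤ ε) : Close dist ε f f :=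
  ⟨OrderIso.refl _, LogSlopeLE.id hε, fun s _ => by simpa using hε⟩

/-- A scale at which closeness can be inverted and composed to reach scale `ε`. -/
noncomputable def smallScale (ε : ℝ) : ℝ := min ε 1 / 4

theorem smallScale_pos {ε : ℝ} (hε : 0 < ε) : 0 < smallScale ε := by
  unfold smallScale; positivity

theorem two_mul_smallScale_le {ε : ℝ} (hε : 0 < ε) : 2 * smallScale ε ≤ ε := by
  have := min_le_left ε 1
  unfold smallScale; linarith

/-- A time change at the small scale may stretch `[0, 1/ε]` by the factor `exp (smallScale ε)`; the
image must still lie in the window `[0, 1 / smallScale ε]`. -/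
theorem exp_smallScale_mul_le {ε : ℝ} (hε : 0 < ε) :
    Real.exp (smallScale ε) * smallScale ε ≤ ε := by
  have h0 := smallScale_pos hε
  have h1 : smallScale ε ≤ 1 := by
    have := min_le_right ε 1
    unfold smallScale; linarith
  have h2 : Real.exp (smallScale ε) ≤ 4 :=
    (Real.exp_le_exp.2 h1).trans (by linarith [Real.exp_one_lt_d9])
  have h3 : 4 * smallScale ε ≤ ε := by
    have := min_le_left ε 1
    unfold smallScale; linarith
  nlinarith

theorem LogSlopeLE.apply_mul_smallScale_le {ε : ℝ} (hε : 0 < ε) {l : ℝ≥0 ≃o ℝ≥0}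
    (h : LogSlopeLE (smallScale ε) l) {s : ℝ≥0} (hs : (s : ℝ) * ε ≤ 1) :
    (l s : ℝ) * smallScale ε ≤ 1 := by
  have h1 := h.le_mul (timeChange_zero l) s
  have h0 := smallScale_pos hε
  calc (l s : ℝ) * smallScale ε ≤ (Real.exp (smallScale ε) * s) * smallScale ε := by gcongr
    _ = s * (Real.exp (smallScale ε) * smallScale ε) := by ring
    _ ≤ s * ε := mul_le_mul_of_nonneg_left (exp_smallScale_mul_le hε) s.2
    _ ≤ 1 := hs

theorem Close.symm {f g : ℝ≥0 → S} {ε : ℝ} (hε : 0 < ε) (h : Close dist (smallScale ε) f g) :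
    Close dist ε g f := by
  obtain ⟨l, hl, h⟩ := h
  have h2 := two_mul_smallScale_le hε
  have h0 := smallScale_pos hε
  refine ⟨l.symm, hl.symm.mono (by linarith), fun s hs => ?_⟩
  have := h (l.symm s) (hl.symm.apply_mul_smallScale_le hε hs)
  rw [OrderIso.apply_symm_apply, dist_comm] at this
  linarith

theorem Close.trans {f g k : ℝ≥0 → S} {ε : ℝ} (hε : 0 < ε) (h : Close dist (smallScale ε) f g)
    (h' : Close dist (smallScale ε) g k) : Close dist ε f k := by
  obtain ⟨l, hl, h⟩ := h
  obtain ⟨m, hm, h'⟩ := h'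
  have h2 := two_mul_smallScale_le hε
  have h0 := smallScale_pos hε
  refine ⟨l.trans m, (hm.comp hl).mono (by linarith), fun s hs => ?_⟩
  have h3 := h s ((mul_le_mul_of_nonneg_left (by linarith) s.2).trans hs)
  have h4 := h' (l s) (hl.apply_mul_smallScale_le hε hs)
  exact (dist_triangle _ _ _).trans (by simp only [OrderIso.trans_apply]; linarith)

/-- The Skorokhod uniform structure on cadlag paths. -/
instance : UniformSpace (CadlagPath S) :=
  .ofCore <| .mkOfBasis
    { sets := {U | ∃ ε : ℝ, 0 < ε ∧ U = {p | Close dist ε p.1.1 p.2.1}}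
      nonempty := ⟨_, 1, one_pos, rfl⟩
      inter_sets := by
        rintro _ _ ⟨ε, hε, rfl⟩ ⟨δ, hδ, rfl⟩
        exact ⟨_, ⟨min ε δ, lt_min hε hδ, rfl⟩, fun p hp =>
          ⟨Close.mono hp (min_le_left _ _), Close.mono hp (min_le_right _ _)⟩⟩ }
    (by
      rintro _ ⟨ε, hε, rfl⟩ x
      exact Close.refl x.1 hε.le)
    (by
      rintro _ ⟨ε, hε, rfl⟩
      exact ⟨_, ⟨_, smallScale_pos hε, rfl⟩, fun p hp => Close.symm hε hp⟩)
    (by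
      rintro _ ⟨ε, hε, rfl⟩
      exact ⟨_, ⟨_, smallScale_pos hε, rfl⟩, fun p ⟨y, h1, h2⟩ => Close.trans hε h1 h2⟩)

open Uniformity in
theorem hasBasis_uniformity : (𝓤 (CadlagPath S)).HasBasis (fun ε : ℝ => 0 < ε)
    fun ε => {p | Close dist ε p.1.1 p.2.1} := by
  refine ⟨fun U => ?_⟩
  refine (FilterBasis.mem_filter_iff _).trans ?_
  constructor
  · rintro ⟨_, ⟨ε, hε, rfl⟩, h⟩
    exact ⟨ε, hε, h⟩
  · rintro ⟨ε, hε, h⟩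
    exact ⟨_, ⟨ε, hε, rfl⟩, h⟩

theorem hasBasis_nhds (f : CadlagPath S) : (𝓝 f).HasBasis (fun ε : ℝ => 0 < ε)
    fun ε => {g | Close dist ε f.1 g.1} :=
  nhds_basis_uniformity' hasBasis_uniformity

open Uniformity in
instance : (𝓤 (CadlagPath S)).IsCountablyGenerated := by
  refine HasCountableBasis.isCountablyGenerated (ι := ℕ) (p := fun _ => True)
    (s := fun n => {p | Close dist (1 / ((n : ℝ) + 1)) p.1.1 p.2.1})
    ⟨hasBasis_uniformity.to_hasBasis (fun ε hε => ?_) (fun n _ => ⟨_, by positivity, subset_rfl⟩),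
      Set.to_countable _⟩
  obtain ⟨n, hn⟩ := exists_nat_one_div_lt hε
  exact ⟨n, trivial, fun p hp => Close.mono hp hn.le⟩

/-- Membership in a closed set during an open time interval passes to Skorokhod limits. -/
theorem mem_of_forall_close {F : Set S} (hF : IsClosed F) {s t : ℝ≥0} {f : ℝ≥0 → S}
    (h : ∀ ε > 0, ∃ g, Close dist ε f g ∧ ∀ r, s < r → r < t → g r ∈ F) {r : ℝ≥0} (hsr : s < r)
    (hrt : r < t) : f r ∈ F := by
  rw [← hF.closure_eq, Metric.mem_closure_iff]
  intro η hη
  have hlim : Tendsto (fun ε : ℝ => (Real.exp ε - 1) * r) (𝓝[>] 0) (𝓝 0) := by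
    have : Continuous fun ε : ℝ => (Real.exp ε - 1) * r := by fun_prop
    simpa using (this.tendsto 0).mono_left nhdsWithin_le_nhds
  have hlim2 : Tendsto (fun ε : ℝ => (r : ℝ) * ε) (𝓝[>] 0) (𝓝 0) := by
    have : Continuous fun ε : ℝ => (r : ℝ) * ε := by fun_prop
    simpa using (this.tendsto 0).mono_left nhdsWithin_le_nhds
  have hsr' : (0 : ℝ) < r - s := sub_pos.2 hsr
  have hrt' : (0 : ℝ) < t - r := sub_pos.2 hrt
  -- For small `ε` the time change moves `r` so little that it stays in the open interval `(s, t)`,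
  -- while `r` lies in the window `[0, 1/ε]` and `ε < η`.
  obtain ⟨ε, h1, h2, h3, h4, hε⟩ := (((hlim.eventually_lt_const hsr').and
    ((hlim.eventually_lt_const hrt').and ((hlim2.eventually_lt_const one_pos).and
      (((eventually_lt_nhds hη).filter_mono nhdsWithin_le_nhds).and
        self_mem_nhdsWithin))))).exists
  obtain ⟨g, ⟨l, hl, hd⟩, hg⟩ := h ε hε
  have h5 := abs_le.1 (hl.abs_sub_le (timeChange_zero l) r)
  refine ⟨g (l r), hg _ (NNReal.coe_lt_coe.1 ?_) (NNReal.coe_lt_coe.1 ?_),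
    (hd r h3.le).trans_lt h4⟩ <;> linarith [h5.1, h5.2]

theorem IsCadlag.mem_of_forall_Ioo {T : Type*} [TopologicalSpace T] {f : ℝ≥0 → T}
    (hf : IsCadlag f) {F : Set T} (hF : IsClosed F) {s t : ℝ≥0} (hst : s < t)
    (h : ∀ r, s < r → r < t → f r ∈ F) : f s ∈ F :=
  hF.mem_of_tendsto (hf.1 s) (by
    filter_upwards [Ioo_mem_nhdsGT hst] with r hr using h r hr.1 hr.2)

/-- Just after `s`, `g` stays in a small closed ball around `g s`. If `f` is close to `g` at every
scale, it stays in that ball too, and right-continuity places `f s` there. -/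
instance : T0Space (CadlagPath S) := by
  refine ⟨fun f g hfg => ?_⟩
  have hclose : ∀ ε > 0, Close dist ε f.1 g.1 := by
    intro ε hε
    have h := (hasBasis_nhds f).mem_of_mem hε
    rw [hfg.nhds_eq] at h
    have := mem_of_mem_nhds h
    exact this
  refine Subtype.ext (funext fun s => ?_)
  refine dist_le_zero.1 (le_of_forall_pos_le_add fun η hη => ?_)
  rw [zero_add]
  obtain ⟨t, hst, ht⟩ := (mem_nhdsGT_iff_exists_Ioo_subset).1
    ((g.2.1 s) (Metric.closedBall_mem_nhds (g.1 s) hη))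
  exact f.2.mem_of_forall_Ioo Metric.isClosed_closedBall hst fun r hsr hrt =>
    mem_of_forall_close Metric.isClosed_closedBall
      (fun ε hε => ⟨g.1, hclose ε hε, fun r h1 h2 => ht ⟨h1, h2⟩⟩) hsr hrt

end Metric

/-! ### Completeness -/

theorem IsCadlag.comp_orderIso {S : Type*} [TopologicalSpace S] {f : ℝ≥0 → S} (hf : IsCadlag f)
    (l : ℝ≥0 ≃o ℝ≥0) : IsCadlag fun s => f (l s) := by
  constructor
  · intro t
    refine (hf.1 (l t)).comp (tendsto_nhdsWithin_iff.2
      ⟨(l.continuous.tendsto t).mono_left nhdsWithin_le_nhds, ?_⟩)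
    filter_upwards [self_mem_nhdsWithin] with r hr using l.strictMono hr
  · intro t ht
    obtain ⟨a, ha⟩ := hf.2 (l t) (by simpa [timeChange_zero] using l.strictMono ht)
    refine ⟨a, ha.comp (tendsto_nhdsWithin_iff.2
      ⟨(l.continuous.tendsto t).mono_left nhdsWithin_le_nhds, ?_⟩)⟩
    filter_upwards [self_mem_nhdsWithin] with r hr using l.strictMono hr

/-- Locally uniform limits of cadlag functions are cadlag. -/
theorem IsCadlag.of_forall_dist_le {S : Type*} [MetricSpace S] [CompleteSpace S] {f : ℝ≥0 → S}
    (h : ∀ (T : ℝ≥0) (ε : ℝ), 0 < ε → ∃ g, IsCadlag g ∧ ∀ s ≤ T, dist (f s) (g s) ≤ ε) :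
    IsCadlag f := by
  constructor
  · intro t
    refine Metric.tendsto_nhds.2 fun ε hε => ?_
    obtain ⟨g, hg, hfg⟩ := h (t + 1) (ε / 3) (by positivity)
    filter_upwards [Metric.tendsto_nhds.1 (hg.1 t) (ε / 3) (by positivity),
      Ioo_mem_nhdsGT (show t < t + 1 by simp)] with r hr hrt
    have h1 := hfg r hrt.2.le
    have h2 := hfg t (by simp)
    rw [dist_comm] at h2
    linarith [dist_triangle4 (f r) (g r) (g t) (f t)]
  · intro t ht
    have : (𝓝[<] t).NeBot := nhdsLT_neBot_of_exists_lt ⟨0, ht⟩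
    refine CompleteSpace.complete (f := map f (𝓝[<] t)) ?_
    refine Metric.cauchy_iff.2 ⟨inferInstance, fun ε hε => ?_⟩
    obtain ⟨g, hg, hfg⟩ := h t (ε / 4) (by positivity)
    obtain ⟨a, ha⟩ := hg.2 t ht
    refine ⟨f '' ({r | dist (g r) a < ε / 4} ∩ Set.Iio t), image_mem_map (inter_mem
      (Metric.tendsto_nhds.1 ha (ε / 4) (by positivity)) self_mem_nhdsWithin), ?_⟩
    rintro _ ⟨r, ⟨hr, hrt⟩, rfl⟩ _ ⟨s, ⟨hs, hst⟩, rfl⟩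
    have h1 := hfg r (le_of_lt hrt)
    have h2 := hfg s (le_of_lt hst)
    rw [Set.mem_ofPred_eq, dist_comm] at hs
    rw [Set.mem_ofPred_eq] at hr
    rw [dist_comm] at h2
    linarith [dist_triangle4 (f r) (g r) (g s) (f s), dist_triangle (g r) a (g s)]

/-- The composition of the first `n` time changes of a sequence. -/
def iterComp (l : ℕ → ℝ≥0 ≃o ℝ≥0) : ℕ → ℝ≥0 ≃o ℝ≥0
  | 0 => OrderIso.refl _
  | n + 1 => (iterComp l n).trans (l n)

theorem iterComp_logSlopeLE {l : ℕ → ℝ≥0 ≃o ℝ≥0} (hl : ∀ n, LogSlopeLE ((1 / 2) ^ n) (l n))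
    {n m : ℕ} (h : n ≤ m) :
    LogSlopeLE (2 * (1 / 2) ^ n) ((iterComp l n).symm.trans (iterComp l m)) := by
  -- The exact partial sum of the geometric series is kept, so that the induction closes.
  have key : LogSlopeLE (2 * (1 / 2) ^ n - 2 * (1 / 2) ^ m)
      ((iterComp l n).symm.trans (iterComp l m)) := by
    induction m, h using Nat.le_induction with
    | base => simpa using (show LogSlopeLE 0 id from LogSlopeLE.id le_rfl)
    | succ m hm ih =>
      have h1 := (hl m).comp ih
      have e : (2 * (1 / 2) ^ n - 2 * (1 / 2) ^ m + (1 / 2) ^ m : ℝ) =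
          2 * (1 / 2) ^ n - 2 * (1 / 2) ^ (m + 1) := by ring
      rw [e] at h1
      exact h1
  exact key.mono (by have : (0 : ℝ) ≤ (1 / 2) ^ m := by positivity
                     linarith)

theorem LogSlopeLE.of_tendsto {ε : ℝ} {F : ℕ → ℝ≥0 → ℝ≥0} {f : ℝ≥0 → ℝ≥0}
    (hF : ∀ᶠ n in atTop, LogSlopeLE ε (F n)) (h : ∀ s, Tendsto (fun n => F n s) atTop (𝓝 (f s))) :
    LogSlopeLE ε f := by
  intro s t hst
  have hlim : Tendsto (fun n => (F n t : ℝ) - F n s) atTop (𝓝 ((f t : ℝ) - f s)) :=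
    ((NNReal.continuous_coe.tendsto _).comp (h t)).sub ((NNReal.continuous_coe.tendsto _).comp (h s))
  exact ⟨ge_of_tendsto hlim (hF.mono fun n hn => (hn hst).1),
    le_of_tendsto hlim (hF.mono fun n hn => (hn hst).2)⟩

theorem exp_two_le : Real.exp 2 ≤ 8 := by
  have h : Real.exp 2 = Real.exp 1 * Real.exp 1 := by rw [← Real.exp_add]; norm_num
  have h1 := Real.exp_one_lt_d9
  have h2 := Real.exp_pos 1
  rw [h]; nlinarith

theorem exp_sub_one_le_two_mul {x : ℝ} (h0 : 0 ≤ x) (h1 : x ≤ 1) : Real.exp x - 1 ≤ 2 * x := by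
  have := Real.abs_exp_sub_one_le (x := x) (by rwa [abs_of_nonneg h0])
  rw [abs_of_nonneg h0] at this
  exact (le_abs_self _).trans this

theorem iterComp_le {l : ℕ → ℝ≥0 ≃o ℝ≥0} (hl : ∀ n, LogSlopeLE ((1 / 2) ^ n) (l n))
    (n : ℕ) (s : ℝ≥0) : (iterComp l n s : ℝ) ≤ 8 * s := by
  have h := iterComp_logSlopeLE hl (Nat.zero_le n)
  have h1 := h.le_mul (timeChange_zero _) s
  simp only [pow_zero, mul_one] at h1
  exact h1.trans (mul_le_mul_of_nonneg_right exp_two_le s.2)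

/-- The infinite composition of time changes with summable logarithmic slopes. -/
theorem exists_limit_iterComp {l : ℕ → ℝ≥0 ≃o ℝ≥0} (hl : ∀ n, LogSlopeLE ((1 / 2) ^ n) (l n)) :
    ∃ k : ℝ≥0 ≃o ℝ≥0, ∀ n, LogSlopeLE (2 * (1 / 2) ^ n) (k.symm.trans (iterComp l n)) := by
  have hlim : ∀ s, ∃ r, Tendsto (fun n => iterComp l n s) atTop (𝓝 r) := by
    intro s
    refine cauchySeq_tendsto_of_complete (cauchySeq_of_le_geometric (1 / 2) (16 * s) (by norm_num)
      fun n => ?_)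
    rw [dist_comm, NNReal.dist_eq]
    have h1 := (hl n).abs_sub_le (timeChange_zero _) (iterComp l n s)
    have h2 := exp_sub_one_le_two_mul (x := (1 / 2) ^ n) (by positivity)
      (pow_le_one₀ (by norm_num) (by norm_num))
    have h3 := iterComp_le hl n s
    calc _ ≤ _ := h1
      _ ≤ 2 * (1 / 2) ^ n * (8 * s) := by gcongr
      _ = _ := by ring
  choose f hf using hlim
  have hslope : ∀ n, LogSlopeLE (2 * (1 / 2) ^ n) (fun s => f ((iterComp l n).symm s)) := by
    intro n
    refine LogSlopeLE.of_tendsto (F := fun m => (iterComp l n).symm.trans (iterComp l m)) ?_ ?_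
    · filter_upwards [eventually_ge_atTop n] with m hm using iterComp_logSlopeLE hl hm
    · intro s
      exact hf _
  have hf0 : f 0 = 0 := by
    refine tendsto_nhds_unique (hf 0) ?_
    simp [timeChange_zero]
  obtain ⟨k, rfl⟩ := (show LogSlopeLE _ f from hslope 0).exists_orderIso hf0
  -- Slope bounds are invariant under inversion, so the bound for the tail of the composition passes
  -- to its inverse.
  exact ⟨k, fun n => (show LogSlopeLE _ ((iterComp l n).symm.trans k) from hslope n).symm⟩

/-- All paths are read on the time scale of the first one: `y n` is `u n` after the first `n` time
changes. These converge locally uniformly to a cadlag `f`, and the limit path is `f` composed with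
the inverse of the infinite composition `k`. -/
instance {S : Type*} [MetricSpace S] [CompleteSpace S] : CompleteSpace (CadlagPath S) := by
  refine UniformSpace.complete_of_convergent_controlled_sequences
    (fun n => {p | Close dist ((1 / 2) ^ n) p.1.1 p.2.1})
    (fun n => hasBasis_uniformity.mem_of_mem (by positivity)) fun u hu => ?_
  choose l hl using fun n => hu n n (n + 1) le_rfl n.le_succ
  obtain ⟨k, hk⟩ := exists_limit_iterComp fun n => (hl n).1
  set y : ℕ → ℝ≥0 → S := fun n s => (u n).1 (iterComp l n s) with hy
  -- As `iterComp l n s ≤ 8 * s`, the condition `8 * s ≤ 2 ^ N` keeps this time in the window `[0, 2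
  -- ^ n]` of the `n`-th matching.
  have hstep : ∀ (s : ℝ≥0) (N n : ℕ), 8 * (s : ℝ) ≤ 2 ^ N → N ≤ n →
      dist (y n s) (y (n + 1) s) ≤ (1 / 2) ^ n := by
    intro s N n hN hn
    refine (hl n).2 (iterComp l n s) ?_
    have h1 := iterComp_le (fun n => (hl n).1) n s
    have h2 : (2 : ℝ) ^ N ≤ 2 ^ n := pow_le_pow_right₀ (by norm_num) hn
    calc (iterComp l n s : ℝ) * (1 / 2) ^ n ≤ 2 ^ n * (1 / 2) ^ n := by gcongr; linarith
      _ = 1 := by rw [← mul_pow]; norm_num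
  have hlim : ∀ s, ∃ a, Tendsto (fun n => y n s) atTop (𝓝 a) := by
    intro s
    obtain ⟨N, hN⟩ := pow_unbounded_of_one_lt (8 * (s : ℝ)) (one_lt_two)
    have hc : CauchySeq fun n => y (n + N) s := by
      refine cauchySeq_of_le_geometric (1 / 2) 1 (by norm_num) fun n => ?_
      rw [add_right_comm]
      refine (hstep s N (n + N) hN.le (Nat.le_add_left _ _)).trans ?_
      rw [one_mul]
      exact pow_le_pow_of_le_one (by norm_num) (by norm_num) (Nat.le_add_right _ _)
    obtain ⟨a, ha⟩ := cauchySeq_tendsto_of_complete hc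
    exact ⟨a, (tendsto_add_atTop_iff_nat N).1 ha⟩
  choose f hf using hlim
  have hdist : ∀ (s : ℝ≥0) (n : ℕ), 8 * (s : ℝ) ≤ 2 ^ n → dist (y n s) (f s) ≤ 2 * (1 / 2) ^ n := by
    intro s n hn
    have h1 := dist_le_of_le_geometric_of_tendsto₀ (f := fun m => y (m + n) s) (a := f s) (1 / 2)
      ((1 / 2) ^ n) (by norm_num) (fun m => by
        rw [add_right_comm, ← pow_add, add_comm n m]
        exact hstep s n (m + n) hn (Nat.le_add_left _ _))
      ((tendsto_add_atTop_iff_nat n).2 (hf s))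
    rw [zero_add] at h1
    refine h1.trans (le_of_eq ?_)
    ring
  have hpow : Tendsto (fun n : ℕ => (2 : ℝ) * (1 / 2) ^ n) atTop (𝓝 0) := by
    simpa using (tendsto_pow_atTop_nhds_zero_of_lt_one (r := (1 / 2 : ℝ)) (by norm_num)
      (by norm_num)).const_mul 2
  have hpow2 : Tendsto (fun n : ℕ => (2 : ℝ) ^ n) atTop atTop :=
    tendsto_pow_atTop_atTop_of_one_lt one_lt_two
  have hfc : IsCadlag f := by
    refine IsCadlag.of_forall_dist_le fun T ε hε => ?_
    obtain ⟨n, h1, h2⟩ := ((hpow.eventually_le_const hε).and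
      (hpow2.eventually_ge_atTop (8 * (T : ℝ)))).exists
    refine ⟨y n, (u n).2.comp_orderIso _, fun s hs => ?_⟩
    rw [dist_comm]
    refine (hdist s n (le_trans ?_ h2)).trans h1
    have : (s : ℝ) ≤ T := hs
    linarith
  refine ⟨⟨fun s => f (k.symm s), hfc.comp_orderIso k.symm⟩, ?_⟩
  refine (hasBasis_nhds _).tendsto_right_iff.2 fun ε hε => ?_
  -- One factor `8` bounds `k.symm s` by `8 / ε` on the window, the other is required by `hdist`.
  filter_upwards [hpow.eventually_le_const hε, hpow2.eventually_ge_atTop (64 / ε)] with n h1 h2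
  refine ⟨k.symm.trans (iterComp l n), (hk n).mono h1, fun s hs => ?_⟩
  rw [dist_comm]
  refine (hdist (k.symm s) n (le_trans ?_ h2)).trans h1
  have h3 : (k.symm s : ℝ) ≤ 8 * s := by
    have h4 : LogSlopeLE 2 k.symm := by simpa [iterComp] using hk 0
    exact (h4.le_mul (timeChange_zero _) s).trans (mul_le_mul_of_nonneg_right exp_two_le s.2)
  rw [le_div_iff₀ hε]
  nlinarith

/-! ### Separability by coding paths -/

section Metric

variable {S : Type*} [MetricSpace S]

/-- `[s, t)` splits into consecutive intervals on which `f` stays within `ε` of the prescribed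
centres and whose lengths lie in the prescribed windows `[exp (ε m), exp (ε (m + 1)))`. -/
def Coded (ε : ℝ) (f : ℝ≥0 → S) : List (S × ℤ) → ℝ≥0 → ℝ≥0 → Prop
  | [], s, t => s = t
  | (c, m) :: L, s, t => ∃ u, s < u ∧ Real.exp (ε * m) ≤ (u : ℝ) - s ∧
      (u : ℝ) - s ≤ Real.exp (ε * (m + 1)) ∧ (∀ r, s ≤ r → r < u → dist (f r) c ≤ ε) ∧
      Coded ε f L u t

theorem Coded.append {ε : ℝ} {f : ℝ≥0 → S} {L M : List (S × ℤ)} {s t u : ℝ≥0}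
    (h : Coded ε f L s t) (h' : Coded ε f M t u) : Coded ε f (L ++ M) s u := by
  induction L generalizing s with
  | nil => obtain rfl : s = t := h; exact h'
  | cons p L ih =>
    obtain ⟨v, h1, h2, h3, h4, h5⟩ := h
    exact ⟨v, h1, h2, h3, h4, ih h5⟩

theorem exists_coded_singleton {ε : ℝ} (hε : 0 < ε) {f : ℝ≥0 → S} {c : S} {s t : ℝ≥0}
    (hst : s < t) (h : ∀ r, s ≤ r → r < t → dist (f r) c ≤ ε) : ∃ m, Coded ε f [(c, m)] s t := by
  have h0 : (0 : ℝ) < (t : ℝ) - s := sub_pos.2 hst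
  refine ⟨⌊Real.log ((t : ℝ) - s) / ε⌋, t, hst, ?_, ?_, h, rfl⟩
  · rw [← Real.le_log_iff_exp_le h0, mul_comm, ← le_div_iff₀ hε]
    exact Int.floor_le _
  · rw [← Real.log_le_iff_le_exp h0, mul_comm, ← div_le_iff₀ hε]
    exact (Int.lt_floor_add_one _).le

/-- Codes concatenate, and on a short interval on either side of any time the path stays near its
value or its left limit, hence near a point of `D`. So `rel_zero_of_locally` applies. -/
theorem exists_coded {D : Set S} (hD : Dense D) {ε : ℝ} (hε : 0 < ε) {f : ℝ≥0 → S}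
    (hf : IsCadlag f) (T : ℝ≥0) : ∃ L : List (D × ℤ),
      Coded ε f (L.map fun p => ((p.1 : S), p.2)) 0 T := by
  refine rel_zero_of_locally (P := fun s t => ∃ L : List (D × ℤ),
      Coded ε f (L.map fun p => ((p.1 : S), p.2)) s t) ⟨[], rfl⟩ ?_ ?_ ?_ T
  · rintro a b c ⟨L, hL⟩ ⟨M, hM⟩
    refine ⟨L ++ M, ?_⟩
    rw [List.map_append]
    exact hL.append hM
  · intro t
    obtain ⟨c, hcD, hc⟩ := hD.exists_dist_lt (f t) (half_pos hε)
    obtain ⟨u, hu, hsub⟩ := (mem_nhdsGT_iff_exists_Ioo_subset).1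
      ((hf.1 t) (Metric.ball_mem_nhds (f t) (half_pos hε)))
    filter_upwards [Ioo_mem_nhdsGT hu] with r hr
    obtain ⟨m, hm⟩ := exists_coded_singleton (f := f) (c := c) hε hr.1 fun q htq hqr => by
      rcases htq.eq_or_lt with rfl | htq
      · linarith
      · have : dist (f q) (f t) < ε / 2 := hsub ⟨htq, hqr.trans hr.2⟩
        linarith [dist_triangle (f q) (f t) c]
    exact ⟨[(⟨c, hcD⟩, m)], hm⟩
  · intro t ht
    obtain ⟨a, ha⟩ := hf.2 t ht
    obtain ⟨c, hcD, hc⟩ := hD.exists_dist_lt a (half_pos hε)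
    obtain ⟨u, hu, hsub⟩ := (mem_nhdsLT_iff_exists_Ioo_subset' ht).1
      (ha (Metric.ball_mem_nhds a (half_pos hε)))
    filter_upwards [Ioo_mem_nhdsLT hu] with r hr
    obtain ⟨m, hm⟩ := exists_coded_singleton (f := f) (c := c) hε hr.2 fun q hrq hqt => by
      have : dist (f q) a < ε / 2 := hsub ⟨hr.1.trans_le hrq, hqt⟩
      linarith [dist_triangle (f q) a c]
    exact ⟨[(⟨c, hcD⟩, m)], hm⟩

/-- Functions with the same code are matched by a time change. -/
theorem Coded.exists_timeChange {ε : ℝ} (hε : 0 ≤ ε) {f g : ℝ≥0 → S} {L : List (S × ℤ)}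
    {s t s' t' : ℝ≥0} (h : Coded ε f L s t) (h' : Coded ε g L s' t') :
    ∃ l : ℝ≥0 ≃o ℝ≥0, LogSlopeLE ε l ∧
      ∀ r, s + r < t → dist (f (s + r)) (g (s' + l r)) ≤ 2 * ε := by
  induction L generalizing s s' with
  | nil =>
    obtain rfl : s = t := h
    exact ⟨OrderIso.refl _, LogSlopeLE.id hε, fun r hr => absurd hr (by simp)⟩
  | cons p L ih =>
    obtain ⟨c, m⟩ := p
    obtain ⟨u, h1, h2, h3, h4, h5⟩ := h
    obtain ⟨u', h1', h2', h3', h4', h5'⟩ := h'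
    obtain ⟨k, hk, hkd⟩ := ih h5 h5'
    obtain ⟨b, rfl⟩ := exists_add_of_le h1.le
    obtain ⟨b', rfl⟩ := exists_add_of_le h1'.le
    simp only [NNReal.coe_add, add_sub_cancel_left] at h2 h3 h2' h3'
    -- The ends of a length window differ by the factor `exp ε`, so pieces with the same index are
    -- matched by a linear map with logarithmic slope at most `ε`.
    have e : Real.exp (ε * (m + 1)) = Real.exp ε * Real.exp (ε * m) := by
      rw [← Real.exp_add]; ring_nf
    rw [e] at h3 h3'
    obtain ⟨l₀, hl₀, hl₀b⟩ := exists_linear (a := b) (b := b') (ε := ε) (by simpa using h1)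
      (by simpa using h1') (h3'.trans (by gcongr)) (h3.trans (by gcongr))
    obtain ⟨l, hl, hl1, hl2⟩ := exists_glue (b := b) (fun s t hst _ => hl₀ hst) hk
    refine ⟨l, hl, fun r hr => ?_⟩
    rcases lt_or_ge r b with hrb | hrb
    · have h6 := h4 (s + r) (le_add_of_nonneg_right zero_le) (by gcongr)
      have h7 := h4' (s' + l r) (le_add_of_nonneg_right zero_le) (by
        rw [hl1 r hrb.le, ← hl₀b]
        gcongr)
      linarith [dist_triangle_right (f (s + r)) (g (s' + l r)) c]
    · obtain ⟨q, rfl⟩ := exists_add_of_le hrb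
      rw [hl2, hl₀b, ← add_assoc, ← add_assoc]
      exact hkd q (by rwa [add_assoc])

/-- There are countably many codes with centres in a countable dense set. One path for each code
that occurs approximates all paths with that code. -/
instance [SecondCountableTopology S] : SecondCountableTopology (CadlagPath S) := by
  refine UniformSpace.secondCountable_of_almost_dense_set fun U hU => ?_
  obtain ⟨ε, hε, hεU⟩ := hasBasis_uniformity.mem_iff.1 hU
  obtain ⟨D, hDc, hD⟩ := TopologicalSpace.exists_countable_dense S
  have : Countable D := hDc.to_subtype
  -- A code controls the half-open `[0, T)`; the added `1` brings in the time `1/ε`.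
  set T : ℝ≥0 := (1 / ε).toNNReal + 1
  choose F hF using fun f : CadlagPath S => exists_coded hD (half_pos hε) f.2 T
  refine ⟨Set.range (Set.rangeSplitting F), Set.countable_range _, ?_⟩
  refine Set.eq_univ_of_forall fun f => ?_
  simp only [Set.mem_iUnion]
  refine ⟨_, ⟨⟨F f, f, rfl⟩, rfl⟩, hεU ?_⟩
  have hc := hF (Set.rangeSplitting F ⟨F f, f, rfl⟩)
  rw [Set.apply_rangeSplitting F] at hc
  obtain ⟨l, hl, h⟩ := hc.exists_timeChange (half_pos hε).le (hF f)
  refine ⟨l, hl.mono (by linarith), fun s hs => ?_⟩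
  have hsT : 0 + s < T := by
    rw [zero_add]
    refine lt_of_le_of_lt ?_ (lt_add_one _)
    rw [← NNReal.coe_le_coe, Real.coe_toNNReal _ (by positivity), le_div_iff₀ hε]
    exact hs
  have h1 := h s hsT
  simp only [zero_add] at h1
  linarith

end Metric

/-! ### Comparison with the local Skorokhod topology -/

theorem explosionTime_eq_top_iff {S : Type*} {x : ℝ≥0 → OnePoint S} :
    explosionTime x = ⊤ ↔ ∀ t, x t ≠ OnePoint.infty := by
  simp [explosionTime, iInf_eq_top]

theorem tendsto_coe_iff {α S : Type*} [TopologicalSpace S] {l : Filter α} {f : α → S} {a : S} :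
    Tendsto (fun t => (f t : OnePoint S)) l (𝓝 (a : OnePoint S)) ↔ Tendsto f l (𝓝 a) :=
  OnePoint.isOpenEmbedding_coe.isInducing.tendsto_nhds_iff.symm

theorem explosionTime_coe {S : Type*} (f : ℝ≥0 → S) :
    explosionTime (fun t => (f t : OnePoint S)) = ⊤ :=
  explosionTime_eq_top_iff.2 fun _ => OnePoint.coe_ne_infty _

variable {S : Type*} [TopologicalSpace S]

theorem exists_coe_eq (x : DGlob S) (t : ℝ≥0) : ∃ a : S, (a : OnePoint S) = x.1.1 t :=
  OnePoint.ne_infty_iff_exists.1 (explosionTime_eq_top_iff.1 x.2 t)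

theorem isCadlag_of_coe_eq (x : DGlob S) {f : ℝ≥0 → S} (hf : ∀ t, (f t : OnePoint S) = x.1.1 t) :
    IsCadlag f := by
  have hx : (fun t => (f t : OnePoint S)) = x.1.1 := funext hf
  have htop : explosionTime x.1.1 = ⊤ := x.2
  constructor
  · intro t
    have := x.1.2.1.2.1 t (by rw [htop]; exact coe_lt_top)
    rw [← hx] at this
    exact tendsto_coe_iff.1 this
  · intro t ht
    obtain ⟨a, ha⟩ := x.1.2.1.2.2 t ht (by rw [htop]; exact coe_lt_top)
    rw [← hx] at ha
    exact ⟨a, tendsto_coe_iff.1 ha⟩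

theorem IsCadlag.coe_mem_DLoc {f : ℝ≥0 → S} (hf : IsCadlag f) :
    (fun t => (f t : OnePoint S)) ∈ DLoc S := by
  refine ⟨⟨fun t ht => ?_, fun t _ => tendsto_coe_iff.2 (hf.1 t), fun t ht _ => ?_⟩,
    fun _ h => ?_⟩
  · rw [explosionTime_coe] at ht
    exact absurd ht (by simp)
  · obtain ⟨a, ha⟩ := hf.2 t ht
    exact ⟨a, tendsto_coe_iff.2 ha⟩
  · rw [explosionTime_coe] at h
    exact absurd h (lt_irrefl _)

/-- Paths with infinite lifetime are cadlag functions with values in `S`. -/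
noncomputable def cadlagEquiv : DGlob S ≃ CadlagPath S where
  toFun x := ⟨fun t => (exists_coe_eq x t).choose,
    isCadlag_of_coe_eq x fun t => (exists_coe_eq x t).choose_spec⟩
  invFun f := ⟨⟨_, f.2.coe_mem_DLoc⟩, explosionTime_coe _⟩
  left_inv x := Subtype.ext (Subtype.ext (funext fun t => (exists_coe_eq x t).choose_spec))
  right_inv f := Subtype.ext (funext fun t =>
    OnePoint.coe_injective (exists_coe_eq ⟨⟨_, f.2.coe_mem_DLoc⟩, explosionTime_coe _⟩ t).choose_spec)

theorem coe_cadlagEquiv (x : DGlob S) (t : ℝ≥0) :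
    ((cadlagEquiv x).1 t : OnePoint S) = x.1.1 t :=
  (exists_coe_eq x t).choose_spec

theorem distExt_coe (d : CompatMetric S) (a b : S) :
    distExt d (a : OnePoint S) (b : OnePoint S) = ENNReal.ofReal (d.metric.dist a b) := rfl

theorem distExt_triangle (d : CompatMetric S) (a b c : OnePoint S) :
    distExt d a c ≤ distExt d a b + distExt d b c := by
  have key : ∀ a b c : S, ENNReal.ofReal (d.metric.dist a c) ≤
      ENNReal.ofReal (d.metric.dist a b) + ENNReal.ofReal (d.metric.dist b c) := by
    intro a b c
    let := d.metric
    exact (ENNReal.ofReal_le_ofReal (dist_triangle a b c)).trans ENNReal.ofReal_add_le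
  rcases a with _ | a <;> rcases b with _ | b <;> rcases c with _ | c <;>
    first
      | exact key a b c
      | exact le_top
      | exact le_of_le_of_eq le_top (top_add _).symm
      | exact le_of_le_of_eq le_top (add_top _).symm
      | exact zero_le

theorem supDist_mono (d : CompatMetric S) {I J : Set ℝ≥0} (h : I ⊆ J) (x y : ℝ≥0 → OnePoint S)
    (l : ℝ≥0 ≃o ℝ≥0) : supDist d I x y l ≤ supDist d J x y l :=
  biSup_mono h

theorem supDist_trans_le (d : CompatMetric S) (T : ℝ≥0) (x y z : ℝ≥0 → OnePoint S)
    (l m : ℝ≥0 ≃o ℝ≥0) : supDist d (Set.Iic T) x z (l.trans m) ≤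
      supDist d (Set.Iic T) x y l + supDist d (Set.Iic (l T)) y z m := by
  refine iSup₂_le fun s hs => (distExt_triangle d _ (y (l s)) _).trans (add_le_add ?_ ?_)
  · exact le_iSup₂ (f := fun s (_ : s ∈ Set.Iic T) => distExt d (x s) (y (l s))) s hs
  · exact le_iSup₂ (f := fun s (_ : s ∈ Set.Iic (l T)) => distExt d (y s) (z (m s))) (l s)
      (l.monotone hs)

/-- Local convergence controls the paths up to every time before the explosion of the limit. -/
theorem LocConv.exists_forall_lt {d : CompatMetric S} {ys : ℕ → DLoc S} {y : DLoc S}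
    (h : LocConv d ys y) : ∃ m : ℕ → ℝ≥0 ≃o ℝ≥0, (∀ k, m k ∈ timeChanges) ∧
      ∀ t : ℝ≥0, (t : ℝ≥0∞) < explosionTime y.1 →
        (∀ᶠ k in atTop, (m k t : ℝ≥0∞) < explosionTime (ys k).1) ∧
        Tendsto (fun k => supDist d (Set.Iic t) y.1 (ys k).1 (m k)) atTop (𝓝 0) ∧
        Tendsto (fun k => logSlopeNorm (m k) t) atTop (𝓝 0) := by
  obtain ⟨m, hm, ⟨⟨hξ, -⟩, h1, h2, -, h3⟩ | ⟨-, h⟩⟩ := h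
  · refine ⟨m, hm, fun t ht => ?_⟩
    have ht' : t < (explosionTime y.1).toNNReal := by
      rwa [← ENNReal.coe_lt_coe, ENNReal.coe_toNNReal hξ.ne]
    refine ⟨?_, ?_, ?_⟩
    · filter_upwards [h1] with k hk
      exact lt_of_lt_of_le (ENNReal.coe_lt_coe.2 ((m k).strictMono ht')) hk
    · exact tendsto_of_tendsto_of_tendsto_of_le_of_le tendsto_const_nhds h2 (fun _ => zero_le)
        fun k => supDist_mono d (fun s hs => lt_of_le_of_lt hs ht') _ _ _
    · exact tendsto_of_tendsto_of_tendsto_of_le_of_le tendsto_const_nhds h3 (fun _ => zero_le)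
        fun k => logSlopeNorm_mono _ ht'.le
  · exact ⟨m, hm, h⟩

/-- The local paths that can be matched to `x` on `[0, T]` up to less than `ε`. -/
def localNhd (d : CompatMetric S) (x : ℝ≥0 → OnePoint S) (T : ℝ≥0) (ε : ℝ≥0∞) : Set (DLoc S) :=
  {y | ∃ l ∈ timeChanges, (l T : ℝ≥0∞) < explosionTime y.1 ∧
    supDist d (Set.Iic T) x y.1 l < ε ∧ logSlopeNorm l T < ε}

/-- The strict inequalities leave room: if `l` matches `y` to `x` and `m k` matches `ys k` to `y`,
then `l` followed by `m k` matches `ys k` to `x` for large `k`. Since `l T` precedes the explosion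
of `y`, both kinds of local convergence give enough control. -/
theorem isOpen_localNhd (d : CompatMetric S) (x : ℝ≥0 → OnePoint S) (T : ℝ≥0) (ε : ℝ≥0∞) :
    IsOpen[localSkorokhod d] (localNhd d x T ε) := by
  rintro y ⟨l, hl, hξ, h1, h2⟩ ys hys
  obtain ⟨m, hm, h⟩ := hys.exists_forall_lt
  obtain ⟨h3, h4, h5⟩ := h (l T) hξ
  have h6 : Tendsto (fun k => supDist d (Set.Iic T) x y.1 l +
      supDist d (Set.Iic (l T)) y.1 (ys k).1 (m k)) atTop
      (𝓝 (supDist d (Set.Iic T) x y.1 l)) := by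
    simpa using tendsto_const_nhds.add h4
  have h7 : Tendsto (fun k => logSlopeNorm l T + logSlopeNorm (m k) (l T)) atTop
      (𝓝 (logSlopeNorm l T)) := by
    simpa using tendsto_const_nhds.add h5
  filter_upwards [h3, h6.eventually_lt_const h1, h7.eventually_lt_const h2] with k k3 k6 k7
  exact ⟨l.trans (m k), trans_mem_timeChanges hl (hm k), k3,
    (supDist_trans_le d T _ _ _ _ _).trans_lt k6, (logSlopeNorm_trans_le _ _ _).trans_lt k7⟩

theorem supDist_refl (d : CompatMetric S) (I : Set ℝ≥0) (x : ℝ≥0 → OnePoint S) :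
    supDist d I x x (OrderIso.refl _) = 0 := by
  refine le_antisymm (iSup₂_le fun s _ => ?_) zero_le
  rcases h : x s with _ | a
  · simp only [OrderIso.refl_apply, h]; exact le_rfl
  · simp only [OrderIso.refl_apply, h]
    let := d.metric
    exact (ENNReal.ofReal_eq_zero.2 (dist_self a).le).le

theorem self_mem_localNhd (d : CompatMetric S) (x : DGlob S) (T : ℝ≥0) {ε : ℝ≥0∞} (hε : 0 < ε) :
    x.1 ∈ localNhd d x.1.1 T ε := by
  have hid : LogSlopeLE 0 (OrderIso.refl ℝ≥0) := LogSlopeLE.id le_rfl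
  refine ⟨OrderIso.refl _, hid.mem_timeChanges, ?_, ?_, ?_⟩
  · rw [show explosionTime x.1.1 = ⊤ from x.2]; exact coe_lt_top
  · rwa [supDist_refl]
  · exact (hid.logSlopeNorm_le le_rfl T).trans_lt (by simpa using hε)

/-- The slopes of `l` are controlled only on `[0, 1/ε]`; beyond, it is replaced by a continuation of
slope one. -/
theorem close_of_mem_localNhd (d : CompatMetric S) {x y : DGlob S} {ε : ℝ} (hε : 0 < ε)
    (h : y.1 ∈ localNhd d x.1.1 (1 / ε).toNNReal (ENNReal.ofReal ε)) :
    Close d.metric.dist ε (cadlagEquiv x).1 (cadlagEquiv y).1 := by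
  obtain ⟨l, -, -, h1, h2⟩ := h
  obtain ⟨k, hk, hkl, -⟩ := exists_glue ((logSlopeNorm_le_iff hε.le l _).1 h2.le)
    (m := OrderIso.refl _) (LogSlopeLE.id hε.le)
  refine ⟨k, hk, fun s hs => ?_⟩
  have hsT : s ≤ (1 / ε).toNNReal := by
    rw [← NNReal.coe_le_coe, Real.coe_toNNReal _ (by positivity), le_div_iff₀ hε]
    exact hs
  have h3 := (le_iSup₂ (f := fun s (_ : s ∈ Set.Iic (1 / ε).toNNReal) =>
    distExt d (x.1.1 s) (y.1.1 (l s))) s hsT).trans h1.le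
  rw [← coe_cadlagEquiv, ← coe_cadlagEquiv, distExt_coe, ENNReal.ofReal_le_ofReal_iff hε.le] at h3
  rwa [hkl s hsT]

theorem tendsto_of_eventually_matches (d : CompatMetric S) {x : DGlob S} {ys : ℕ → DGlob S}
    {l : ℕ → ℝ≥0 ≃o ℝ≥0}
    (h : ∀ ε > 0, ∀ᶠ k in atTop,
      Matches d.metric.dist ε (cadlagEquiv x).1 (cadlagEquiv (ys k)).1 (l k)) (t : ℝ≥0) :
    Tendsto (fun k => supDist d (Set.Iic t) x.1.1 (ys k).1.1 (l k)) atTop (𝓝 0) ∧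
      Tendsto (fun k => logSlopeNorm (l k) t) atTop (𝓝 0) := by
  have key : ∀ η : ℝ≥0∞, 0 < η → ∀ᶠ k in atTop,
      supDist d (Set.Iic t) x.1.1 (ys k).1.1 (l k) ≤ η ∧ logSlopeNorm (l k) t ≤ η := by
    intro η hη
    obtain ⟨ε, hε, hεη⟩ : ∃ ε : ℝ, 0 < ε ∧ ENNReal.ofReal ε ≤ η := by
      obtain ⟨r, hr0, hr⟩ := ENNReal.lt_iff_exists_nnreal_btwn.1 hη
      exact ⟨r, by exact_mod_cast hr0, by rw [ENNReal.ofReal_coe_nnreal]; exact hr.le⟩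
    -- The second term makes the window `[0, 1/δ]` contain `[0, t]`.
    set δ := min ε (1 / (t + 1))
    have hδ : 0 < δ := by positivity
    filter_upwards [h δ hδ] with k ⟨h1, h2⟩
    have hδη : ENNReal.ofReal δ ≤ η := (ENNReal.ofReal_le_ofReal (min_le_left _ _)).trans hεη
    refine ⟨iSup₂_le fun s hs => ?_, (h1.logSlopeNorm_le hδ.le t).trans hδη⟩
    rw [← coe_cadlagEquiv, ← coe_cadlagEquiv, distExt_coe]
    refine (ENNReal.ofReal_le_ofReal (h2 s ?_)).trans hδη
    have hst : (s : ℝ) ≤ t := hs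
    calc (s : ℝ) * δ ≤ (t + 1) * (1 / (t + 1)) := by
          gcongr
          · linarith
          · exact min_le_right _ _
      _ = 1 := by field_simp
  exact ⟨ENNReal.tendsto_nhds_zero.2 fun η hη => (key η hη).mono fun _ h => h.1,
    ENNReal.tendsto_nhds_zero.2 fun η hη => (key η hη).mono fun _ h => h.2⟩

theorem LocConv.of_forall_tendsto {d : CompatMetric S} {x : DGlob S} {ys : ℕ → DGlob S}
    {l : ℕ → ℝ≥0 ≃o ℝ≥0} (hl : ∀ k, l k ∈ timeChanges)
    (h : ∀ t : ℝ≥0, Tendsto (fun k => supDist d (Set.Iic t) x.1.1 (ys k).1.1 (l k)) atTop (𝓝 0) ∧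
      Tendsto (fun k => logSlopeNorm (l k) t) atTop (𝓝 0)) :
    LocConv d (fun k => (ys k).1) x.1 := by
  refine ⟨l, hl, .inr ⟨.inl x.2, fun t _ => ⟨.of_forall fun k => ?_, h t⟩⟩⟩
  rw [show explosionTime (ys k).1.1 = ⊤ from (ys k).2]
  exact coe_lt_top

theorem LocConv.tendsto_globalSkorokhod {d : CompatMetric S} {x : DGlob S} {ys : ℕ → DGlob S}
    (h : LocConv d (fun k => (ys k).1) x.1) :
    Tendsto ys atTop (@nhds _ (globalSkorokhod d) x) := by
  let := localSkorokhod d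
  rw [nhds_induced, tendsto_comap_iff, tendsto_nhds]
  exact fun U hU hxU => hU _ hxU _ h

/-- The relation `Close` gives a neighbourhood basis of the global Skorokhod topology. -/
theorem hasBasis_nhds_globalSkorokhod (d : CompatMetric S) (x : DGlob S) :
    (@nhds _ (globalSkorokhod d) x).HasBasis (fun ε : ℝ => 0 < ε)
      fun ε => {y | Close d.metric.dist ε (cadlagEquiv x).1 (cadlagEquiv y).1} := by
  refine ⟨fun U => ⟨fun hU => ?_, fun ⟨ε, hε, hU⟩ => ?_⟩⟩
  -- Otherwise there are points outside `U` at every scale `1 / (n + 1)`; they converge locally to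
  -- `x`, so they eventually enter `U`.
  · by_contra! hcon
    have hn : ∀ n : ℕ, ∃ y : DGlob S, y ∉ U ∧
        Close d.metric.dist (1 / ((n : ℝ) + 1)) (cadlagEquiv x).1 (cadlagEquiv y).1 := by
      intro n
      obtain ⟨y, hy, hyU⟩ := Set.not_subset.1 (hcon (1 / ((n : ℝ) + 1)) (by positivity))
      exact ⟨y, hyU, hy⟩
    choose ys hysU l hl using hn
    have hmatch : ∀ ε > 0, ∀ᶠ k in atTop,
        Matches d.metric.dist ε (cadlagEquiv x).1 (cadlagEquiv (ys k)).1 (l k) := by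
      intro ε hε
      filter_upwards [tendsto_one_div_add_atTop_nhds_zero_nat.eventually_le_const hε] with k hk
      exact (hl k).mono hk
    have hconv := LocConv.of_forall_tendsto (fun k => (hl k).1.mem_timeChanges)
      (tendsto_of_eventually_matches d hmatch)
    obtain ⟨k, hk⟩ := (hconv.tendsto_globalSkorokhod.eventually hU).exists
    exact hysU k hk
  · let := localSkorokhod d
    rw [nhds_induced, mem_comap]
    refine ⟨_, (isOpen_localNhd d x.1.1 (1 / ε).toNNReal (ENNReal.ofReal ε)).mem_nhds
      (self_mem_localNhd d x _ (ENNReal.ofReal_pos.2 hε)), fun y hy => hU ?_⟩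
    exact close_of_mem_localNhd d hε hy

theorem globalSkorokhod_le [LocallyCompactSpace S] (d d' : CompatMetric S) :
    globalSkorokhod d ≤ globalSkorokhod d' := by
  refine (@le_iff_nhds _ (globalSkorokhod d) (globalSkorokhod d')).2 fun x => ?_
  refine ((hasBasis_nhds_globalSkorokhod d x).le_basis_iff
    (hasBasis_nhds_globalSkorokhod d' x)).2 fun ε hε => ?_
  obtain ⟨δ, hδ, h⟩ := exists_close_imp_close d d' (cadlagEquiv x).2 hε
  exact ⟨δ, hδ, fun y hy => h _ hy⟩

/-- Time changes that match up to any `ε`, eventually, can be chosen independently of `ε`. -/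
theorem exists_forall_eventually_of_mono {α : Type*} [Nonempty α] {p : ℕ → ℝ → α → Prop}
    (hmono : ∀ k a ε δ, ε ≤ δ → p k ε a → p k δ a)
    (h : ∀ ε > 0, ∀ᶠ k in atTop, ∃ a, p k ε a) :
    ∃ l : ℕ → α, ∀ ε > 0, ∀ᶠ k in atTop, p k ε (l k) := by
  classical
  set φ : ℕ → ℝ := fun k => sInf {ε : ℝ | 0 < ε ∧ ∃ a, p k ε a} with hφ
  have hbdd : ∀ k, BddBelow {ε : ℝ | 0 < ε ∧ ∃ a, p k ε a} := fun k => ⟨0, fun ε hε => hε.1.le⟩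
  -- The infimum of the admissible scales need not be attained, hence the added `1 / (k + 1)`. The
  -- default value below is used only when no positive scale is admissible.
  set r : ℕ → ℝ := fun k => φ k + 1 / ((k : ℝ) + 1) with hr
  refine ⟨fun k => if hk : ∃ a, p k (r k) a then hk.choose else Classical.arbitrary α,
    fun ε hε => ?_⟩
  filter_upwards [h (ε / 2) (half_pos hε),
    tendsto_one_div_add_atTop_nhds_zero_nat.eventually_le_const (half_pos hε)] with k hk hk'
  have hφk : φ k ≤ ε / 2 := csInf_le (hbdd k) ⟨half_pos hε, hk⟩
  have hpos : (0 : ℝ) < 1 / ((k : ℝ) + 1) := by positivity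
  obtain ⟨δ, ⟨hδ, a, ha⟩, hδr⟩ := exists_lt_of_csInf_lt (s := {ε : ℝ | 0 < ε ∧ ∃ a, p k ε a})
    ⟨_, half_pos hε, hk⟩ (show φ k < r k by simp only [hr]; linarith)
  have hex : ∃ a, p k (r k) a := ⟨a, hmono _ _ _ _ hδr.le ha⟩
  rw [dif_pos hex]
  exact hmono _ _ _ _ (by simp only [hr]; linarith) hex.choose_spec

theorem tendsto_globalSkorokhod_iff (d : CompatMetric S) (xs : ℕ → DGlob S) (x : DGlob S) :
    Tendsto xs atTop (@nhds (DGlob S) (globalSkorokhod d) x) ↔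
      ∃ l : ℕ → ℝ≥0 ≃o ℝ≥0, (∀ k, l k ∈ timeChanges) ∧
        ∀ t : ℝ≥0,
          Tendsto (fun k => supDist d (Set.Iic t) x.1.1 (xs k).1.1 (l k)) atTop (𝓝 0) ∧
          Tendsto (fun k => logSlopeNorm (l k) t) atTop (𝓝 0) := by
  constructor
  · intro h
    have h1 := (hasBasis_nhds_globalSkorokhod d x).tendsto_right_iff.1 h
    have : Nonempty {l : ℝ≥0 ≃o ℝ≥0 // l ∈ timeChanges} :=
      ⟨⟨OrderIso.refl _, (show LogSlopeLE 0 (OrderIso.refl ℝ≥0) from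
        LogSlopeLE.id le_rfl).mem_timeChanges⟩⟩
    obtain ⟨l, hl⟩ := exists_forall_eventually_of_mono (α := {l // l ∈ timeChanges})
      (p := fun k ε l => Matches d.metric.dist ε (cadlagEquiv x).1 (cadlagEquiv (xs k)).1 l.1)
      (fun k l ε δ hεδ h => h.mono hεδ)
      (fun ε hε => (h1 ε hε).mono fun k ⟨l, hl⟩ => ⟨⟨l, hl.1.mem_timeChanges⟩, hl⟩)
    exact ⟨fun k => (l k).1, fun k => (l k).2, tendsto_of_eventually_matches d hl⟩
  · rintro ⟨l, hl, h⟩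
    exact (LocConv.of_forall_tendsto hl h).tendsto_globalSkorokhod

/-! ### Polishness of the state space -/

/-- A locally compact dense subspace of a Hausdorff space is open. -/
theorem isOpen_range_of_isInducing_of_denseRange {X Y : Type*} [TopologicalSpace X] [TopologicalSpace Y]
    [LocallyCompactSpace X] [T2Space Y] {i : X → Y} (hi : IsInducing i) (hd : DenseRange i) :
    IsOpen (Set.range i) := by
  refine isOpen_iff_mem_nhds.2 ?_
  rintro _ ⟨x, rfl⟩
  obtain ⟨K, hK, hKx⟩ := exists_compact_mem_nhds x
  rw [hi.nhds_eq_comap, mem_comap] at hKx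
  obtain ⟨V, hV, hVK⟩ := hKx
  obtain ⟨U, hUV, hU, hxU⟩ := mem_nhds_iff.1 hV
  refine mem_of_superset (hU.mem_nhds hxU) ?_
  refine (hd.open_subset_closure_inter hU).trans
    ((closure_minimal ?_ (hK.image hi.continuous).isClosed).trans (Set.image_subset_range i K))
  rintro _ ⟨hyU, y, rfl⟩
  exact ⟨y, hVK (hUV hyU), rfl⟩

/-- By local compactness `S` is open in its completion, which is Polish. -/
theorem polishSpace_of_locallyCompact {S : Type*} [MetricSpace S] [LocallyCompactSpace S]
    [SecondCountableTopology S] : PolishSpace S := by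
  have hi : IsEmbedding ((↑) : S → UniformSpace.Completion S) :=
    UniformSpace.Completion.isUniformEmbedding_coe S |>.isEmbedding
  have : PolishSpace (Set.range ((↑) : S → UniformSpace.Completion S)) :=
    (isOpen_range_of_isInducing_of_denseRange hi.isInducing
      UniformSpace.Completion.denseRange_coe).polishSpace
  exact hi.toHomeomorph.isClosedEmbedding.polishSpace

/-! ### Topology and Borel sets of the global path space -/

section Metric

variable {S : Type*} [MetricSpace S]

theorem globalSkorokhod_eq_induced :
    globalSkorokhod (⟨‹MetricSpace S›, rfl⟩ : CompatMetric S) =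
      TopologicalSpace.induced cadlagEquiv inferInstance := by
  refine TopologicalSpace.ext_nhds fun x => ?_
  rw [nhds_induced cadlagEquiv x]
  exact (hasBasis_nhds_globalSkorokhod _ x).eq_of_same_basis
    ((hasBasis_nhds (cadlagEquiv x)).comap cadlagEquiv)

theorem isClosed_setOf_forall_mem {F : Set S} (hF : IsClosed F) (s t : ℝ≥0) :
    IsClosed {f : CadlagPath S | ∀ r, s < r → r < t → f.1 r ∈ F} := by
  refine isClosed_of_closure_subset fun f hf r hsr hrt => ?_
  refine mem_of_forall_close hF (fun ε hε => ?_) hsr hrt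
  obtain ⟨g, hg, h⟩ := mem_closure_iff_nhds.1 hf _ ((hasBasis_nhds f).mem_of_mem hε)
  exact ⟨g.1, hg, h⟩

/-- Evaluation need not be continuous. By right-continuity, however, `f s ∈ U` means that for some
`n`, `m` the path keeps distance at least `1/n` from the complement of `U` throughout `(s, s + 1 /
(m + 1))`, and this condition is closed. -/
theorem measurable_eval [MeasurableSpace S] [BorelSpace S] [MeasurableSpace (CadlagPath S)]
    [BorelSpace (CadlagPath S)] (s : ℝ≥0) : Measurable fun f : CadlagPath S => f.1 s := by
  refine measurable_of_isOpen fun U hU => ?_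
  have hF : ∀ n : ℕ, IsClosed {a : S | (n : ℝ≥0∞)⁻¹ ≤ Metric.infEDist a Uᶜ} := fun n =>
    isClosed_le continuous_const Metric.continuous_infEDist
  have : (fun f : CadlagPath S => f.1 s) ⁻¹' U = ⋃ (n : ℕ) (m : ℕ),
      {f : CadlagPath S | ∀ r, s < r → r < s + 1 / ((m : ℝ≥0) + 1) →
        f.1 r ∈ {a : S | (n : ℝ≥0∞)⁻¹ ≤ Metric.infEDist a Uᶜ}} := by
    ext f
    simp only [Set.mem_preimage, Set.mem_iUnion]
    constructor
    · intro hf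
      have hpos : Metric.infEDist (f.1 s) Uᶜ ≠ 0 := fun h => by
        have := Metric.mem_closure_iff_infEDist_zero.2 h
        rw [hU.isClosed_compl.closure_eq] at this
        exact this hf
      obtain ⟨n, hn⟩ := ENNReal.exists_inv_nat_lt hpos
      have hev : ∀ᶠ r in 𝓝[>] s, (n : ℝ≥0∞)⁻¹ < Metric.infEDist (f.1 r) Uᶜ :=
        (f.2.1 s).eventually
          ((isOpen_lt continuous_const Metric.continuous_infEDist).mem_nhds hn)
      obtain ⟨u, hu, hsub⟩ := (mem_nhdsGT_iff_exists_Ioo_subset).1 hev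
      have hu' : (0 : ℝ) < (u : ℝ) - s := sub_pos.2 hu
      obtain ⟨m, hm⟩ := exists_nat_one_div_lt hu'
      refine ⟨n, m, fun r hsr hrm => ?_⟩
      have hr : (n : ℝ≥0∞)⁻¹ < Metric.infEDist (f.1 r) Uᶜ := hsub ⟨hsr, hrm.trans ?_⟩
      · exact hr.le
      rw [← NNReal.coe_lt_coe]
      push_cast
      linarith
    · rintro ⟨n, m, h⟩
      have hs : (n : ℝ≥0∞)⁻¹ ≤ Metric.infEDist (f.1 s) Uᶜ :=
        f.2.mem_of_forall_Ioo (hF n) (lt_add_of_pos_right s (by positivity)) h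
      by_contra hsU
      rw [Metric.infEDist_zero_of_mem (show f.1 s ∈ Uᶜ from hsU)] at hs
      exact (ENNReal.inv_pos.2 (ENNReal.natCast_ne_top n)).not_ge hs
  rw [this]
  exact .iUnion fun n => .iUnion fun m => (isClosed_setOf_forall_mem (hF n) _ _).measurableSet

/-- A cadlag function is determined by its values at the points of a dense set. -/
theorem CadlagPath.ext_of_dense {D : Set ℝ≥0} (hD : Dense D) {f g : CadlagPath S}
    (h : ∀ r ∈ D, f.1 r = g.1 r) : f = g := by
  refine Subtype.ext (funext fun s => ?_)
  have hs : s ∈ closure (Set.Ioi s ∩ D) := by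
    refine closure_minimal (hD.open_subset_closure_inter isOpen_Ioi) isClosed_closure ?_
    rw [closure_Ioi]
    exact Set.self_mem_Ici
  have : (𝓝[Set.Ioi s ∩ D] s).NeBot := mem_closure_iff_nhdsWithin_neBot.1 hs
  have hle : 𝓝[Set.Ioi s ∩ D] s ≤ 𝓝[>] s := nhdsWithin_mono s Set.inter_subset_left
  refine tendsto_nhds_unique ((f.2.1 s).mono_left hle) (((g.2.1 s).mono_left hle).congr' ?_)
  filter_upwards [self_mem_nhdsWithin] with r hr using (h r hr.2).symm

/-- Countably many evaluations embed the Polish path space injectively and measurably in a product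
of copies of `S`. By Lusin–Souslin this is a measurable embedding, so every Borel set is a preimage.
-/
theorem borel_cadlagPath [CompleteSpace S] [SecondCountableTopology S] :
    borel (CadlagPath S) =
      ⨆ s : ℝ≥0, MeasurableSpace.comap (fun f : CadlagPath S => f.1 s) (borel S) := by
  borelize S
  borelize (CadlagPath S)
  refine le_antisymm ?_ (iSup_le fun s => (measurable_eval s).comap_le)
  obtain ⟨D, hDc, hD⟩ := TopologicalSpace.exists_countable_dense ℝ≥0
  have : Countable D := hDc.to_subtype
  have hmeas : Measurable fun (f : CadlagPath S) (r : D) => f.1 r.1 :=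
    measurable_pi_lambda _ fun r => measurable_eval r.1
  have hemb := hmeas.measurableEmbedding fun f g hfg =>
    CadlagPath.ext_of_dense hD fun r hr => congrFun hfg ⟨r, hr⟩
  refine hemb.comap_eq.ge.trans ?_
  rw [MeasurableSpace.pi, MeasurableSpace.comap_iSup]
  refine iSup_le fun r => ?_
  rw [MeasurableSpace.comap_comp]
  exact le_iSup (fun s : ℝ≥0 => MeasurableSpace.comap (fun f : CadlagPath S => f.1 s) (borel S)) r.1

end Metric

theorem canonicalSigma_eq_comap {S : Type*} [TopologicalSpace S] :
    canonicalSigma S = MeasurableSpace.comap cadlagEquiv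
      (⨆ s : ℝ≥0, MeasurableSpace.comap (fun f : CadlagPath S => f.1 s) (borel S)) := by
  have hcoe : borel S = MeasurableSpace.comap ((↑) : S → OnePoint S) (borel (OnePoint S)) := by
    rw [← borel_comap, ← OnePoint.isOpenEmbedding_coe.isInducing.eq_induced]
  rw [canonicalSigma, MeasurableSpace.comap_iSup]
  refine iSup_congr fun s => ?_
  rw [hcoe, MeasurableSpace.comap_comp, MeasurableSpace.comap_comp]
  exact congrArg (MeasurableSpace.comap · _) (funext fun x => (coe_cadlagEquiv x s).symm)

/-- The given metric need not be complete, but the topology is the same for a complete metric on the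
Polish space `S`. -/
theorem polishSpace_globalSkorokhod {S : Type*} [TopologicalSpace S] [LocallyCompactSpace S]
    [SecondCountableTopology S] (d : CompatMetric S) :
    @PolishSpace (DGlob S) (globalSkorokhod d) ∧
      @borel (DGlob S) (globalSkorokhod d) = canonicalSigma S := by
  have hP : PolishSpace S := by
    obtain ⟨m, rfl⟩ := d
    exact polishSpace_of_locallyCompact
  obtain ⟨m, rfl, hc⟩ := hP.toIsCompletelyMetrizableSpace.complete
  rw [(globalSkorokhod_le d _).antisymm (globalSkorokhod_le _ d), globalSkorokhod_eq_induced]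
  exact ⟨Equiv.polishSpace_induced _, by
    rw [borel_comap, borel_cadlagPath, canonicalSigma_eq_comap]⟩

end Skorokhod

theorem corollary2 {S : Type*} [TopologicalSpace S] [LocallyCompactSpace S] [T2Space S]
    [SecondCountableTopology S] (d : Skorokhod.CompatMetric S) :
    -- the global Skorokhod topology is Polish
    @PolishSpace (Skorokhod.DGlob S) (Skorokhod.globalSkorokhod d) ∧
    -- convergence of sequences
    (∀ (xs : ℕ → Skorokhod.DGlob S) (x : Skorokhod.DGlob S),
      Tendsto xs atTop (@nhds (Skorokhod.DGlob S) (Skorokhod.globalSkorokhod d) x) ↔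
        ∃ l : ℕ → ℝ≥0 ≃o ℝ≥0, (∀ k, l k ∈ Skorokhod.timeChanges) ∧
          ∀ t : ℝ≥0,
            Tendsto (fun k => Skorokhod.supDist d (Set.Iic t) x.1.1 (xs k).1.1 (l k))
              atTop (𝓝 0) ∧
            Tendsto (fun k => Skorokhod.logSlopeNorm (l k) t) atTop (𝓝 0)) ∧
    -- independence of the metric
    (∀ d' : Skorokhod.CompatMetric S,
      Skorokhod.globalSkorokhod d' = Skorokhod.globalSkorokhod d) ∧
    -- the Borel sigma-algebra
    @borel (Skorokhod.DGlob S) (Skorokhod.globalSkorokhod d) = Skorokhod.canonicalSigma S := by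
  obtain ⟨hP, hB⟩ := Skorokhod.polishSpace_globalSkorokhod d
  exact ⟨hP, Skorokhod.tendsto_globalSkorokhod_iff d,
    fun d' => (Skorokhod.globalSkorokhod_le d' d).antisymm (Skorokhod.globalSkorokhod_le d d'), hB⟩
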